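/- Let $d\ge 0$ be an integer, let $\mathbb{F}_d^*$ be the unital free semigroup on $d$ generators (the words in the letters $1,\dots,d$, with the empty word $\varnothing$ as unit), and write $|w|$ for the length of a word $w$. Let $\ell^2(\mathbb{F}_d^*)$ be the Hilbert space with orthonormal basis $\{\xi_w : w\in\mathbb{F}_d^*\}$, let $L_u$ be the isometry on it with $L_u\xi_w=\xi_{uw}$, and let $\mathcal{L}=\mathcal{L}_d\subset B(\ell^2(\mathbb{F}_d^*))$ be the unital algebra generated by $\{L_u : u\in\mathbb{F}_d^*\}$, closed in the weak operator topology (WOT). The weak* topology on operators is the $\sigma$-weak topology. Let $\Delta$ be the comultiplication of $\mathcal{L}$, that is, the weak*-continuous unital homomorphism $\Delta:\mathcal{L}\to\mathcal{L}\,\overline{\otimes}\,\mathcal{L}\subset B(\ell^2(\mathbb{F}_d^*)\otimes\ell^2(\mathbb{F}_d^*))$ with $\Delta(L_w)=L_w\otimes L_w$ for all $w\in\mathbb{F}_d^*$. A subset $\mathcal{J}\subset\mathcal{L}$ is a *Hopf ideal* if it is a WOT-closed two-sided ideal of $\mathcal{L}$ and a coideal, i.e. a weak*-closed subspace with $$\Delta(\mathcal{J})\subseteq\overline{\mathcal{J}\otimes\mathcal{L}+\mathcal{L}\otimes\mathcal{J}}^{\,w^*}.$$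 It is *homogeneous* if it is the weak*-closed linear span of its homogeneous elements, an element of $\mathcal{L}$ being homogeneous if, for some $n\ge 0$, it is a linear combination of operators $L_w$ with $|w|=n$. Let $\mathbb{F}_d^{*0}$ be the semigroup obtained from $\mathbb{F}_d^*$ by adjoining a zero element $0$, and put $L_0:=0$. A *semigroup congruence* on $\mathbb{F}_d^{*0}$ is an equivalence relation compatible with the multiplication; it is *homogeneous* if $u\sim v$ and $u\not\sim 0$ imply $|u|=|v|$. **Theorem.** Let $\mathcal{J}\subset\mathcal{L}$. Then the following statements are equivalent: (i) $\mathcal{J}$ is a homogeneous Hopf ideal of $\mathcal{L}$. (ii) There is a homogeneous semigroup congruence $\sim$ on $\mathbb{F}_d^{*0}$ such that $$\mathcal{J}=\overline{\operatorname{span}}^{\,w^*}\{L_u-L_v : u,v\in\mathbb{F}_d^{*0},\ u\sim v\}.$$ -/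

import Mathlib

open scoped ENNReal InnerProductSpace Topology

noncomputable section

namespace FreeSemigroupAlgebra

/-! ### Operator topologies -/

/-- The weak operator topology on `B(H)`, transported from Mathlib's type copy. -/
@[reducible] def wotTopology (H : Type*) [NormedAddCommGroup H] [InnerProductSpace ℂ H] :
    TopologicalSpace (H →L[ℂ] H) :=
  TopologicalSpace.induced ContinuousLinearMapWOT.ofCLM
    (inferInstance : TopologicalSpace (H →WOT[ℂ] H))

/-- The weak* (ultraweak, σ-weak) topology on `B(H)`: the coarsest topology that makes all the
functionals `A ↦ ∑ₙ ⟪xₙ, A yₙ⟫` with `∑ₙ ‖xₙ‖² < ∞` and `∑ₙ ‖yₙ‖² < ∞` continuous. These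
functionals are exactly the elements of the predual (the trace class operators) of `B(H)`. -/
@[reducible] def weakStarTopology (H : Type*) [NormedAddCommGroup H] [InnerProductSpace ℂ H] :
    TopologicalSpace (H →L[ℂ] H) :=
  TopologicalSpace.induced
    (fun (A : H →L[ℂ] H) (p : lp (fun _ : ℕ => H) 2 × lp (fun _ : ℕ => H) 2) =>
      ∑' n, ⟪p.1 n, A (p.2 n)⟫_ℂ)
    Pi.topologicalSpace

/-- The weak*-closed linear span of a set of operators. -/
def weakStarSpan {H : Type*} [NormedAddCommGroup H] [InnerProductSpace ℂ H]
    (S : Set (H →L[ℂ] H)) : Set (H →L[ℂ] H) :=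
  closure[weakStarTopology H] (Submodule.span ℂ S : Set (H →L[ℂ] H))

/-! ### Operators acting fibrewise on an `ℓ²` space -/

/-- The Hilbert space `ℓ²(X)`. -/
abbrev L2 (X : Type*) : Type _ := lp (fun _ : X => ℂ) 2

/-- The standard orthonormal basis vector `ξ_x` of `ℓ²(X)`. -/
def basisVec {X : Type*} (x : X) : L2 X :=
  letI := Classical.decEq X
  lp.single 2 x (1 : ℂ)

section Fibre

variable {W I X : Type*}

lemma summable_sq (f : L2 X) : Summable (fun x => ‖f x‖ ^ 2) := by
  have := (lp.memℓp f).summable (by norm_num)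
  simpa using this

lemma norm_sq_eq (f : L2 X) : ‖f‖ ^ 2 = ∑' x, ‖f x‖ ^ 2 := by
  have := lp.norm_rpow_eq_tsum (p := 2) (by norm_num) f
  simpa using this

lemma memlp_of_summable {f : X → ℂ} (h : Summable (fun x => ‖f x‖ ^ 2)) : Memℓp f 2 := by
  apply memℓp_gen
  simpa using h

/-- The restriction of `f ∈ ℓ²(X)` to the fibre over `i`, where `X` is identified with `I × W`. -/
def slice (e : I × W ≃ X) (i : I) : L2 X →ₗ[ℂ] L2 W where
  toFun f := ⟨fun w => f (e (i, w)), memlp_of_summable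
    ((summable_sq f).comp_injective (e.injective.comp (Prod.mk_right_injective i)))⟩
  map_add' f g := by ext w; rfl
  map_smul' c f := by ext w; rfl

@[simp] lemma slice_apply (e : I × W ≃ X) (i : I) (f : L2 X) (w : W) :
    slice e i f w = f (e (i, w)) := rfl

lemma hasSum_slice (e : I × W ≃ X) (f : L2 X) :
    HasSum (fun i => ‖slice e i f‖ ^ 2) (‖f‖ ^ 2) := by
  have h1 : HasSum (fun x => ‖f x‖ ^ 2) (‖f‖ ^ 2) := by
    rw [norm_sq_eq]; exact (summable_sq f).hasSum
  have h2 := (e.hasSum_iff (f := fun x => ‖f x‖ ^ 2)).2 h1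
  refine h2.prod_fiberwise fun i => ?_
  rw [norm_sq_eq]
  exact (summable_sq (slice e i f)).hasSum

lemma summable_fibre (e : I × W ≃ X) (A : L2 W →L[ℂ] L2 W) (f : L2 X) :
    Summable (fun p : I × W => ‖A (slice e p.1 f) p.2‖ ^ 2) := by
  refine (summable_prod_of_nonneg fun p => by positivity).2
    ⟨fun i => summable_sq (A (slice e i f)), ?_⟩
  refine Summable.of_nonneg_of_le (fun i => tsum_nonneg fun w => by positivity) (fun i => ?_)
    ((hasSum_slice e f).summable.mul_left (‖A‖ ^ 2))
  refine (norm_sq_eq (A (slice e i f))).symm.trans_le ?_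
  rw [← mul_pow]
  exact pow_le_pow_left₀ (norm_nonneg _) (A.le_opNorm _) 2

lemma tsum_fibre_le (e : I × W ≃ X) (A : L2 W →L[ℂ] L2 W) (f : L2 X) :
    ∑' p : I × W, ‖A (slice e p.1 f) p.2‖ ^ 2 ≤ (‖A‖ * ‖f‖) ^ 2 := by
  rw [(summable_fibre e A f).tsum_prod, mul_pow, ← (hasSum_slice e f).tsum_eq, ← tsum_mul_left]
  refine Summable.tsum_le_tsum (fun i => ?_) (summable_fibre e A f).prod
    ((hasSum_slice e f).summable.mul_left (‖A‖ ^ 2))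
  refine (norm_sq_eq (A (slice e i f))).symm.trans_le ?_
  rw [← mul_pow]
  exact pow_le_pow_left₀ (norm_nonneg _) (A.le_opNorm _) 2

/-- Underlying vector of `fibrewise`. -/
def fibrewiseFun (e : I × W ≃ X) (A : L2 W →L[ℂ] L2 W) (f : L2 X) : L2 X :=
  ⟨fun x => A (slice e (e.symm x).1 f) (e.symm x).2, memlp_of_summable
    ((e.symm.summable_iff (f := fun p : I × W => ‖A (slice e p.1 f) p.2‖ ^ 2)).2
      (summable_fibre e A f))⟩

lemma norm_fibrewiseFun_le (e : I × W ≃ X) (A : L2 W →L[ℂ] L2 W) (f : L2 X) :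
    ‖fibrewiseFun e A f‖ ≤ ‖A‖ * ‖f‖ := by
  refine (sq_le_sq₀ (norm_nonneg _) (by positivity)).1 ?_
  rw [norm_sq_eq]
  refine le_trans (le_of_eq ?_) (tsum_fibre_le e A f)
  exact e.symm.tsum_eq (fun p : I × W => ‖A (slice e p.1 f) p.2‖ ^ 2)

/-- Given an identification `e : I × W ≃ X`, so that `ℓ²(X) = ⨁_{i ∈ I} ℓ²(W)`, this sends
`A ∈ B(ℓ²(W))` to the operator `⨁_{i ∈ I} A` on `ℓ²(X)`. -/
def fibrewise (e : I × W ≃ X) : (L2 W →L[ℂ] L2 W) →ₐ[ℂ] (L2 X →L[ℂ] L2 X) :=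
  AlgHom.ofLinearMap
    { toFun := fun A => LinearMap.mkContinuous
        { toFun := fibrewiseFun e A
          map_add' := fun f g => by
            ext x
            simp only [fibrewiseFun, map_add]
            rfl
          map_smul' := fun c f => by
            ext x
            simp only [fibrewiseFun, map_smul]
            rfl }
        ‖A‖ (norm_fibrewiseFun_le e A)
      map_add' := fun A B => by ext f x; rfl
      map_smul' := fun c A => by ext f x; rfl }
    (by ext f x; simp [fibrewiseFun])
    (fun A B => by
      ext f x
      have h : slice e (e.symm x).1 (fibrewiseFun e B f) = B (slice e (e.symm x).1 f) := by
        ext w; simp [fibrewiseFun]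
      change A (B (slice e (e.symm x).1 f)) (e.symm x).2 =
        A (slice e (e.symm x).1 (fibrewiseFun e B f)) (e.symm x).2
      rw [h])

lemma fibrewise_apply (e : I × W ≃ X) (A : L2 W →L[ℂ] L2 W) (f : L2 X) (i : I) (w : W) :
    fibrewise e A f (e (i, w)) = A (slice e i f) w := by
  change A (slice e (e.symm (e (i, w))).1 f) (e.symm (e (i, w))).2 = _
  simp

lemma basisVec_apply [DecidableEq X] (x y : X) :
    (basisVec x : L2 X) y = if y = x then 1 else 0 := by
  have e : (basisVec x : L2 X) = lp.single 2 x (1 : ℂ) := by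
    unfold basisVec; congr; exact Subsingleton.elim _ _
  rw [e, lp.single_apply, Pi.single_apply]

lemma fibrewise_basisVec [DecidableEq I] (e : I × W ≃ X) (A : L2 W →L[ℂ] L2 W) (i j : I)
    (w s : W) : fibrewise e A (basisVec (e (i, w))) (e (j, s)) =
      if j = i then A (basisVec w) s else 0 := by
  classical
  rw [fibrewise_apply]
  by_cases h : j = i
  · have : slice e j (basisVec (e (i, w))) = basisVec w := by
      ext t; simp [basisVec_apply, h]
    rw [this, if_pos h]
  · have : slice e j (basisVec (e (i, w))) = 0 := by
      ext t; simp [basisVec_apply, h]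
    rw [this, if_neg h, map_zero]; rfl

/-- Operators on `ℓ²(X)` that agree on the basis vectors are equal. -/
lemma ext_basisVec {A B : L2 X →L[ℂ] L2 X} (h : ∀ x, A (basisVec x) = B (basisVec x)) :
    A = B := by
  classical
  refine lp.ext_continuousLinearMap (by norm_num) fun x => ?_
  ext1
  have e : (basisVec x : L2 X) = lp.single 2 x (1 : ℂ) := by unfold basisVec; congr
  have := h x
  rw [e] at this
  exact this

lemma inner_fibrewise (e : I × W ≃ X) (A : L2 W →L[ℂ] L2 W) (f g : L2 X) :
    HasSum (fun i => ⟪slice e i f, A (slice e i g)⟫_ℂ) ⟪f, fibrewise e A g⟫_ℂ := by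
  have h2 := (e.hasSum_iff (f := fun x => ⟪f x, fibrewise e A g x⟫_ℂ)).2
    (lp.hasSum_inner (𝕜 := ℂ) f (fibrewise e A g))
  refine h2.prod_fiberwise fun i => ?_
  have h3 := lp.hasSum_inner (𝕜 := ℂ) (slice e i f) (A (slice e i g))
  refine h3.congr_fun fun w => ?_
  simp [fibrewise_apply]

/-- `A ↦ ⨁_{i ∈ I} A` is weak*-continuous. -/
lemma continuous_fibrewise [Countable I] [Nonempty I] (e : I × W ≃ X) :
    Continuous[weakStarTopology (L2 W), weakStarTopology (L2 X)] (fibrewise e) := by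
  obtain ⟨k⟩ : Nonempty (ℕ ≃ ℕ × I) := nonempty_equiv_of_countable
  have hs : ∀ x : lp (fun _ : ℕ => L2 X) 2,
      Summable (fun p : ℕ × I => ‖slice e p.2 (x p.1)‖ ^ 2) := by
    intro x
    refine (summable_prod_of_nonneg fun p => by positivity).2
      ⟨fun n => (hasSum_slice e (x n)).summable, ?_⟩
    have := (lp.memℓp x).summable (by norm_num)
    simpa [(hasSum_slice e _).tsum_eq] using this
  let T : lp (fun _ : ℕ => L2 X) 2 → lp (fun _ : ℕ => L2 W) 2 := fun x =>
    ⟨fun n => slice e (k n).2 (x (k n).1), memℓp_gen (by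
      simpa [Function.comp_def] using
        (k.summable_iff (f := fun p : ℕ × I => ‖slice e p.2 (x p.1)‖ ^ 2)).2 (hs x))⟩
  refine continuous_induced_rng.2 (@continuous_pi _ _ _ (weakStarTopology (L2 W)) _ _ fun p => ?_)
  have key : ∀ A : L2 W →L[ℂ] L2 W, ∑' n, ⟪p.1 n, fibrewise e A (p.2 n)⟫_ℂ =
      ∑' n, ⟪T p.1 n, A (T p.2 n)⟫_ℂ := by
    intro A
    have h1 : Summable (fun n => ⟪T p.1 n, A (T p.2 n)⟫_ℂ) := by
      refine Summable.of_norm_bounded (g := fun n => ‖A‖ * (‖T p.1 n‖ ^ 2 + ‖T p.2 n‖ ^ 2)) ?_ ?_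
      · have a := (lp.memℓp (T p.1)).summable (by norm_num)
        have b := (lp.memℓp (T p.2)).summable (by norm_num)
        exact Summable.mul_left _ (by simpa using a.add b)
      · intro n
        have h := (norm_inner_le_norm (𝕜 := ℂ) (T p.1 n) (A (T p.2 n))).trans
          (mul_le_mul_of_nonneg_left (A.le_opNorm _) (norm_nonneg _))
        nlinarith [norm_nonneg A, mul_nonneg (norm_nonneg A) (sq_nonneg (‖T p.1 n‖ - ‖T p.2 n‖)),
          mul_nonneg (norm_nonneg A) (add_nonneg (sq_nonneg ‖T p.1 n‖) (sq_nonneg ‖T p.2 n‖))]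
    have h2 : Summable (fun q : ℕ × I => ⟪slice e q.2 (p.1 q.1), A (slice e q.2 (p.2 q.1))⟫_ℂ) :=
      (k.summable_iff (f := fun q : ℕ × I =>
        ⟪slice e q.2 (p.1 q.1), A (slice e q.2 (p.2 q.1))⟫_ℂ)).1 h1
    have h3 : ∑' n, ⟪T p.1 n, A (T p.2 n)⟫_ℂ =
        ∑' q : ℕ × I, ⟪slice e q.2 (p.1 q.1), A (slice e q.2 (p.2 q.1))⟫_ℂ :=
      k.tsum_eq (fun q : ℕ × I => ⟪slice e q.2 (p.1 q.1), A (slice e q.2 (p.2 q.1))⟫_ℂ)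
    rw [h3, h2.tsum_prod]
    exact tsum_congr fun n => (inner_fibrewise e A (p.1 n) (p.2 n)).tsum_eq.symm
  have hc : Continuous[weakStarTopology (L2 W), inferInstance]
      (fun A : L2 W →L[ℂ] L2 W => ∑' n, ⟪T p.1 n, A (T p.2 n)⟫_ℂ) :=
    @Continuous.comp _ _ _ (weakStarTopology (L2 W)) _ _ _ _
      (continuous_apply (T p.1, T p.2)) continuous_induced_dom
  convert hc using 1
  exact funext key

end Fibre

/-! ### The noncommutative analytic Toeplitz algebra -/

/-- The unital free semigroup on `d` generators; its unit is the empty word. -/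
abbrev Word (d : ℕ) : Type := FreeMonoid (Fin d)

/-- The full Fock space `ℓ²(𝔽_d^*)`. -/
abbrev Fock (d : ℕ) : Type := L2 (Word d)

/-- `ℓ²(𝔽_d^* × 𝔽_d^*)`, which is the Hilbert space tensor product of `ℓ²(𝔽_d^*)` with itself
under `ξ_u ⊗ ξ_v = ξ_(u,v)`. -/
abbrev Fock2 (d : ℕ) : Type := L2 (Word d × Word d)

variable {d : ℕ}

lemma orthonormal_basisVec_comp {X Y : Type*} {g : Y → X}
    (hg : Function.Injective g) : Orthonormal ℂ (fun y => (basisVec (g y) : L2 X)) := by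
  classical
  rw [orthonormal_iff_ite]
  intro y z
  rw [basisVec, basisVec, lp.inner_single_left]
  by_cases h : y = z
  · subst h; simp
  · have : g y ≠ g z := fun h' => h (hg h')
    simp [h, this]

/-- The left regular representation: the isometry `L_u` on `ℓ²(𝔽_d^*)` with
`L_u ξ_w = ξ_{uw}`. -/
def L (u : Word d) : Fock d →L[ℂ] Fock d :=
  (orthonormal_basisVec_comp
    (mul_right_injective u)).orthogonalFamily.linearIsometry.toContinuousLinearMap

lemma L_basisVec (u w : Word d) : L u (basisVec w) = basisVec (u * w) := by
  classical
  have h := (orthonormal_basisVec_comp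
    (mul_right_injective u)).orthogonalFamily.linearIsometry_apply_single (1 : ℂ) (i := w)
  have e : (basisVec w : Fock d) = lp.single 2 w (1 : ℂ) := by
    unfold basisVec; congr
  rw [e]
  refine h.trans ?_
  simp

/-- The free semigroup algebra `𝓛_d`: the smallest unital WOT-closed algebra that contains all
the operators `L_u`. -/
def Lalg (d : ℕ) : Subalgebra ℂ (Fock d →L[ℂ] Fock d) :=
  sInf {S | IsClosed[wotTopology (Fock d)] (S : Set (Fock d →L[ℂ] Fock d)) ∧ ∀ u, L u ∈ S}

/-! ### Tensor products and the comultiplication -/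

/-- The elementary tensor `A ⊗ B = (A ⊗ I)(I ⊗ B)` as an operator on
`ℓ²(𝔽_d^*) ⊗ ℓ²(𝔽_d^*) = ℓ²(𝔽_d^* × 𝔽_d^*)`. -/
def tensor (A B : Fock d →L[ℂ] Fock d) : Fock2 d →L[ℂ] Fock2 d :=
  fibrewise (Equiv.prodComm (Word d) (Word d)) A * fibrewise (Equiv.refl (Word d × Word d)) B

/-- The pairs of words that do not begin with the same letter. -/
def Prefixless (d : ℕ) : Set (Word d × Word d) :=
  {p | ∀ (i : Fin d) (a b : Word d), p ≠ (FreeMonoid.of i * a, FreeMonoid.of i * b)}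

lemma prefix_bijective : Function.Bijective
    (fun q : Prefixless d × Word d => (q.2 * q.1.1.1, q.2 * q.1.1.2)) := by
  constructor
  · rintro ⟨⟨⟨a, b⟩, h⟩, g⟩ ⟨⟨⟨a', b'⟩, h'⟩, g'⟩ heq
    simp only [Prod.mk.injEq] at heq
    obtain ⟨h1, h2⟩ := heq
    suffices hh : g = g' by
      subst hh
      simp only [mul_right_inj] at h1 h2
      subst h1; subst h2; rfl
    induction g using FreeMonoid.inductionOn' generalizing g' with
    | one =>
      induction g' using FreeMonoid.inductionOn' with
      | one => rfl
      | of_mul i g' _ =>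
        exfalso
        simp only [one_mul, mul_assoc] at h1 h2
        exact h i (g' * a') (g' * b') (by rw [← h1, ← h2])
    | of_mul i g ih =>
      induction g' using FreeMonoid.inductionOn' with
      | one =>
        exfalso
        simp only [one_mul, mul_assoc] at h1 h2
        exact h' i (g * a) (g * b) (by rw [h1, h2])
      | of_mul j g' _ =>
        have h1' := List.cons.inj (show i :: (g * a).toList = j :: (g' * a').toList from h1)
        have h2' := List.cons.inj (show i :: (g * b).toList = j :: (g' * b').toList from h2)
        rw [h1'.1, ih g' h1'.2 h2'.2]
  · rintro ⟨s, t⟩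
    induction s using FreeMonoid.inductionOn' generalizing t with
    | one =>
      refine ⟨(⟨(1, t), fun i a b hp => ?_⟩, 1), by simp⟩
      have := congrArg (fun p : Word d × Word d => p.1.length) hp
      simp [FreeMonoid.length_mul] at this
      omega
    | of_mul i s ih =>
      by_cases ht : ∃ t', t = FreeMonoid.of i * t'
      · obtain ⟨t', rfl⟩ := ht
        obtain ⟨⟨p, g⟩, hq⟩ := ih t'
        simp only [Prod.mk.injEq] at hq
        exact ⟨(p, FreeMonoid.of i * g), by simp [mul_assoc, hq.1, hq.2]⟩
      · refine ⟨(⟨(FreeMonoid.of i * s, t), fun j a b hp => ?_⟩, 1), by simp⟩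
        simp only [Prod.mk.injEq] at hp
        have := List.cons.inj (show i :: s.toList = j :: a.toList from hp.1)
        exact ht ⟨b, by rw [this.1]; exact hp.2⟩

/-- Every pair of words is `(ga, gb)` for a unique word `g` (the longest common prefix) and a
unique pair `(a, b)` of words that do not begin with the same letter. -/
def prefixEquiv (d : ℕ) : Prefixless d × Word d ≃ Word d × Word d :=
  Equiv.ofBijective _ prefix_bijective

/-- The comultiplication `Δ`. The space `ℓ²(𝔽_d^* × 𝔽_d^*)` is the orthogonal direct sum, over the
pairs `(a, b)` of words that do not begin with the same letter, of the copies
`span {ξ_(ga,gb) : g}` of `ℓ²(𝔽_d^*)`, and `Δ(A)` acts as `A` on each of them. It is a unital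
algebra homomorphism by construction, it is weak*-continuous (`continuous_comul`), and
`Δ(L_w) = L_w ⊗ L_w` (`comul_L`); on `𝓛_d` these properties determine it.
The formula makes sense on all of `B(ℓ²(𝔽_d^*))`, but it is only used on `𝓛_d`. -/
def comul (d : ℕ) : (Fock d →L[ℂ] Fock d) →ₐ[ℂ] (Fock2 d →L[ℂ] Fock2 d) :=
  fibrewise (prefixEquiv d)

lemma comul_apply_L (w u v : Word d) :
    comul d (L w) (basisVec (u, v)) = basisVec (w * u, w * v) := by
  classical
  obtain ⟨⟨p, g⟩, hp⟩ := (prefixEquiv d).surjective (u, v)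
  have h1 : (w * u, w * v) = prefixEquiv d (p, w * g) := by
    have := Prod.mk.inj hp
    rw [← this.1, ← this.2]
    simp [prefixEquiv, mul_assoc]
  rw [h1, ← hp]
  ext x
  obtain ⟨⟨q, s⟩, rfl⟩ := (prefixEquiv d).surjective x
  rw [comul, fibrewise_basisVec, L_basisVec]
  simp only [basisVec_apply, EmbeddingLike.apply_eq_iff_eq, Prod.mk.injEq]
  split_ifs <;> simp_all

/-- `(A ⊗ B)(ξ_u ⊗ ξ_v) = A ξ_u ⊗ B ξ_v`. -/
lemma tensor_basisVec (A B : Fock d →L[ℂ] Fock d) (u v s t : Word d) :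
    tensor A B (basisVec (u, v)) (s, t) = A (basisVec u) s * B (basisVec v) t := by
  classical
  have h : slice (Equiv.prodComm (Word d) (Word d)) t
      (fibrewise (Equiv.refl (Word d × Word d)) B (basisVec (u, v))) =
        B (basisVec v) t • basisVec u := by
    ext s'
    have := fibrewise_basisVec (Equiv.refl (Word d × Word d)) B u s' v t
    simp only [Equiv.refl_apply] at this
    simp [this, basisVec_apply]
  have h2 := fibrewise_apply (Equiv.prodComm (Word d) (Word d)) A
    (fibrewise (Equiv.refl (Word d × Word d)) B (basisVec (u, v))) t s
  rw [h] at h2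
  refine h2.trans ?_
  simp [mul_comm]

lemma comul_L (w : Word d) : comul d (L w) = tensor (L w) (L w) := by
  classical
  refine ext_basisVec fun ⟨u, v⟩ => ?_
  rw [comul_apply_L]
  ext ⟨s, t⟩
  rw [tensor_basisVec, L_basisVec, L_basisVec]
  simp only [basisVec_apply, Prod.mk.injEq]
  split_ifs <;> simp_all

lemma continuous_comul :
    Continuous[weakStarTopology (Fock d), weakStarTopology (Fock2 d)] (comul d) := by
  have : Nonempty (Prefixless d) := ⟨((prefixEquiv d).symm (1, 1)).1⟩
  have : Countable (Word d) := inferInstanceAs (Countable (List (Fin d)))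
  exact continuous_fibrewise (prefixEquiv d)

/-! ### Homogeneous Hopf ideals -/

/-- The homogeneous elements of degree `n`: linear combinations of the `L_w` with `|w| = n`. -/
def homogeneousPart (d n : ℕ) : Submodule ℂ (Fock d →L[ℂ] Fock d) :=
  Submodule.span ℂ (L '' {w : Word d | w.length = n})

/-- WOT-closed two-sided ideals of `𝓛_d`. -/
structure IsIdeal (J : Set (Fock d →L[ℂ] Fock d)) : Prop where
  subset : J ⊆ Lalg d
  zero_mem : 0 ∈ J
  add_mem : ∀ A ∈ J, ∀ B ∈ J, A + B ∈ J
  mul_mem_left : ∀ A ∈ Lalg d, ∀ B ∈ J, A * B ∈ J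
  mul_mem_right : ∀ A ∈ J, ∀ B ∈ Lalg d, A * B ∈ J
  closed : IsClosed[wotTopology (Fock d)] J

/-- Coideals of `(𝓛_d, Δ)`: weak*-closed subspaces `J` such that `Δ(J)` lies in the weak*-closure
of `J ⊗ 𝓛_d + 𝓛_d ⊗ J`. -/
structure IsCoideal (J : Set (Fock d →L[ℂ] Fock d)) : Prop where
  subset : J ⊆ Lalg d
  zero_mem : 0 ∈ J
  add_mem : ∀ A ∈ J, ∀ B ∈ J, A + B ∈ J
  smul_mem : ∀ (c : ℂ), ∀ A ∈ J, c • A ∈ J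
  closed : IsClosed[weakStarTopology (Fock d)] J
  comul_mem : ∀ A ∈ J, comul d A ∈
    weakStarSpan ({T | ∃ A ∈ J, ∃ B ∈ Lalg d, T = tensor A B} ∪
      {T | ∃ A ∈ Lalg d, ∃ B ∈ J, T = tensor A B})

/-- `J` is homogeneous: it is the weak*-closed span of its homogeneous elements. -/
def IsHomogeneous (J : Set (Fock d →L[ℂ] Fock d)) : Prop :=
  J = weakStarSpan {A | A ∈ J ∧ ∃ n, A ∈ homogeneousPart d n}

/-- Homogeneous Hopf ideals of `𝓛_d`. -/
structure IsHomogeneousHopfIdeal (J : Set (Fock d →L[ℂ] Fock d)) : Prop where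
  isIdeal : IsIdeal J
  isCoideal : IsCoideal J
  isHomogeneous : IsHomogeneous J

/-! ### Homogeneous congruences -/

/-- The semigroup `𝔽_d^{*0}` obtained by adjoining a zero element. -/
abbrev Word0 (d : ℕ) : Type := WithZero (Word d)

/-- The operators `L_u` for `u ∈ 𝔽_d^{*0}`, with the convention `L_0 = 0`. -/
def L0 : Word0 d → (Fock d →L[ℂ] Fock d)
  | none => 0
  | some w => L w

@[simp] lemma L0_zero : L0 (0 : Word0 d) = 0 := rfl

@[simp] lemma L0_coe (w : Word d) : L0 (w : Word0 d) = L w := rfl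

/-- A semigroup congruence on `𝔽_d^{*0}` is homogeneous if equivalent elements that are not
equivalent to `0` (these are words) have the same length. -/
def IsHomogeneousCon (c : Con (Word0 d)) : Prop :=
  ∀ u v : Word d, c (u : Word0 d) (v : Word0 d) → ¬ c (u : Word0 d) 0 → u.length = v.length

end FreeSemigroupAlgebra

end

/-! The coalgebra structure is dual to pointwise multiplication: each `L w` is group-like, so
pairing `Δ(A)` with `f ⊗ g` gives the pairing of `A` with the pointwise product `f * g` of
coefficient functions. For a coideal `J`, the functions on words of length `n` that annihilate the
degree `n` part of `J` are therefore closed under pointwise products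
(`IsHomogeneousHopfIdeal.mul_mem_annihilator`). A possibly nonunital subalgebra of `ℂ^ι` is spanned
by indicators of disjoint sets, so its annihilator is spanned by basis vectors and differences of
basis vectors (`le_span_of_annihilator_mul`). Hence the homogeneous elements of `J` are combinations
of the `L u` and `L u - L v` lying in `J`, and `u ∼ v ↔ L u - L v ∈ J` is the required congruence;
the ideal property makes it compatible with products.

Conversely, the span of the differences of a homogeneous congruence is graded, stable under
multiplication by generators, and sent by `Δ` into the right place because `Δ(a - b) = (a - b) ⊗ a +
b ⊗ (a - b)` for group-like `a`, `b`. The analytic point is that its weak*-closure is also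
WOT-closed. Fejér means, which are bounded and converge weak*, identify this closure with the
elements of `𝓛_d` whose homogeneous components lie in the span (`closure_eq_setOf_homogProj_mem`).
That condition is WOT-closed since each degree is finite-dimensional. -/

noncomputable section

namespace FreeSemigroupAlgebra

/-! ### Subspaces whose annihilator is closed under pointwise products -/

section Annihilator

variable {ι : Type*} [Fintype ι]

/-- The functions on `ι` that annihilate the subspace `M` under the standard pairing. -/
def annihilator (M : Submodule ℂ (ι → ℂ)) : Submodule ℂ (ι → ℂ) where
  carrier := {f | ∀ x ∈ M, ∑ i, f i * x i = 0}
  zero_mem' := by simp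
  add_mem' := fun hf hg x hx => by
    simp only [Pi.add_apply, add_mul, Finset.sum_add_distrib, hf x hx, hg x hx, add_zero]
  smul_mem' := fun c f hf x hx => by
    simp only [Pi.smul_apply, smul_eq_mul, mul_assoc, ← Finset.mul_sum, hf x hx, mul_zero]

lemma exists_mem_annihilator_of_notMem {M : Submodule ℂ (ι → ℂ)} {x : ι → ℂ} (hx : x ∉ M) :
    ∃ f ∈ annihilator M, ∑ i, f i * x i ≠ 0 := by
  classical
  -- A separating functional is represented by its values on the standard basis.
  obtain ⟨φ, hφ, hM⟩ := Submodule.exists_le_ker_of_notMem hx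
  have key : ∀ y : ι → ℂ, ∑ i, φ (Pi.single i 1) * y i = φ y := by
    intro y
    conv_rhs => rw [pi_eq_sum_univ' y, map_sum]
    refine Finset.sum_congr rfl fun i _ => ?_
    rw [map_smul, smul_eq_mul, mul_comm]
  refine ⟨fun i => φ (Pi.single i 1), fun y hy => ?_, ?_⟩
  · rw [key]; exact hM hy
  · rw [key]; exact hφ

variable [DecidableEq ι]

lemma sum_mul_single (f : ι → ℂ) (i : ι) : ∑ j, f j * (Pi.single i 1 : ι → ℂ) j = f i := by
  simp [Pi.single_apply]

/-- A subspace of `ℂ^ι` whose annihilator is closed under pointwise products is spanned by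
standard basis vectors and differences of such. -/
theorem le_span_of_annihilator_mul (M : Submodule ℂ (ι → ℂ))
    (hmul : ∀ f ∈ annihilator M, ∀ g ∈ annihilator M, f * g ∈ annihilator M) :
    M ≤ Submodule.span ℂ ({x | x ∈ M ∧ ∃ i, x = Pi.single i 1} ∪
      {x | x ∈ M ∧ ∃ i j, x = Pi.single i 1 - Pi.single j 1}) := by
  classical
  set S : Submodule ℂ (ι → ℂ) := Submodule.span ℂ ({x | x ∈ M ∧ ∃ i, x = Pi.single i 1} ∪
    {x | x ∈ M ∧ ∃ i j, x = Pi.single i 1 - Pi.single j 1}) with hS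
  -- The classes of `E` are the blocks on which every function in the annihilator is constant.
  let E : ι → ι → Prop := fun i j => (Pi.single i 1 - Pi.single j 1 : ι → ℂ) ∈ M
  have hrefl : ∀ i, E i i := fun i => by simp [E]
  have hsymm : ∀ {i j}, E i j → E j i := fun {i j} h => by
    simpa [E] using M.neg_mem h
  have htrans : ∀ {i j k}, E i j → E j k → E i k := fun {i j k} h h' => by
    simpa [E] using M.add_mem h h'
  have hconst : ∀ N : Submodule ℂ (ι → ℂ), ∀ f ∈ annihilator N, ∀ i j,
      (Pi.single i 1 - Pi.single j 1 : ι → ℂ) ∈ N → f i = f j := by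
    intro N f hf i j hij
    have := hf _ hij
    simp only [Pi.sub_apply, mul_sub, Finset.sum_sub_distrib, sum_mul_single] at this
    exact sub_eq_zero.1 this
  have hzero : ∀ N : Submodule ℂ (ι → ℂ), ∀ f ∈ annihilator N, ∀ i,
      (Pi.single i 1 : ι → ℂ) ∈ N → f i = 0 := by
    intro N f hf i hi
    simpa only [sum_mul_single] using hf _ hi
  -- The annihilator contains the indicator of each class on which it does not vanish identically.
  -- Such an indicator is built as a product of separating functions.
  have hind : ∀ r, (Pi.single r 1 : ι → ℂ) ∉ M →
      (fun i => if E i r then (1 : ℂ) else 0) ∈ annihilator M := by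
    intro r hr
    have hT : ∀ T : Finset ι, (∀ s ∈ T, ¬ E s r) →
        ∃ p ∈ annihilator M, p r ≠ 0 ∧ ∀ s ∈ T, p s = 0 := by
      intro T
      induction T using Finset.induction_on with
      | empty =>
        intro _
        obtain ⟨h, hh, hne⟩ := exists_mem_annihilator_of_notMem hr
        exact ⟨h, hh, by simpa only [sum_mul_single] using hne, by simp⟩
      | insert s T _ ih =>
        intro hs
        obtain ⟨p, hp, hpr, hpT⟩ := ih fun t ht => hs t (Finset.mem_insert_of_mem ht)
        obtain ⟨f, hf, hne⟩ := exists_mem_annihilator_of_notMem (hs s (Finset.mem_insert_self _ _))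
        simp only [Pi.sub_apply, mul_sub, Finset.sum_sub_distrib, sum_mul_single] at hne
        -- This is `p * (f - f s)`, expanded because the constant `f s` need not lie in the
        -- annihilator. The factor vanishes at `s` but not at `r`.
        refine ⟨p * f - f s • p, Submodule.sub_mem _ (hmul p hp f hf)
          (Submodule.smul_mem _ _ hp), ?_, ?_⟩
        · have : (p * f - f s • p) r = - (p r * (f s - f r)) := by
            simp only [Pi.sub_apply, Pi.mul_apply, Pi.smul_apply, smul_eq_mul]; ring
          rw [this]
          exact neg_ne_zero.2 (mul_ne_zero hpr hne)
        · intro t ht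
          simp only [Pi.sub_apply, Pi.mul_apply, Pi.smul_apply, smul_eq_mul]
          rcases Finset.mem_insert.1 ht with rfl | ht
          · ring
          · rw [hpT t ht]; ring
    -- With every point outside the class of `r` killed and `p` constant on the class, `p` is a
    -- nonzero multiple of the indicator.
    obtain ⟨p, hp, hpr, hpT⟩ := hT (Finset.univ.filter fun s => ¬ E s r) (by simp)
    have : (fun i => if E i r then (1 : ℂ) else 0) = (p r)⁻¹ • p := by
      ext i
      by_cases hi : E i r
      · simp [hi, hconst M p hp i r hi, hpr]
      · simp [hi, hpT i (by simp [hi])]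
    rw [this]
    exact Submodule.smul_mem _ _ hp
  intro x hx
  by_contra hxS
  -- By duality it is enough that every `f` annihilating `S` annihilates `M`. Such an `f` is a
  -- combination of the indicators from `hind`.
  obtain ⟨f, hf, hne⟩ := exists_mem_annihilator_of_notMem hxS
  refine hne ?_
  have hfE : ∀ {i j}, E i j → f i = f j := fun {i j} h =>
    hconst S f hf i j (Submodule.subset_span (Or.inr ⟨h, i, j, rfl⟩))
  have hf0 : ∀ i, (Pi.single i 1 : ι → ℂ) ∈ M → f i = 0 := fun i h =>
    hzero S f hf i (Submodule.subset_span (Or.inl ⟨h, i, rfl⟩))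
  -- The sum over all `r` in `hdecomp` meets each class once per element, hence the division by the
  -- class size.
  let n : ι → ℕ := fun i => (Finset.univ.filter fun k => E i k).card
  have hn : ∀ {i j}, E i j → n i = n j := fun {i j} h => by
    refine congrArg Finset.card (Finset.filter_congr fun k _ => ?_)
    exact ⟨htrans (hsymm h), htrans h⟩
  have hdecomp : f = ∑ r, (f r / n r) • (fun i => if E i r then (1 : ℂ) else 0) := by
    ext i
    have hni : (n i : ℂ) ≠ 0 := by
      refine Nat.cast_ne_zero.2 (Finset.card_ne_zero.2 ⟨i, by simp [hrefl]⟩)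
    simp only [Finset.sum_apply, Pi.smul_apply, smul_eq_mul, mul_ite, mul_one, mul_zero]
    rw [← Finset.sum_filter, Finset.sum_congr rfl (g := fun _ => f i / n i)]
    · rw [Finset.sum_const, nsmul_eq_mul]
      exact (mul_div_cancel₀ _ hni).symm
    · intro r hr
      have hr := (Finset.mem_filter.1 hr).2
      rw [hfE hr, hn hr]
  have : f ∈ annihilator M := by
    rw [hdecomp]
    refine Submodule.sum_mem _ fun r _ => ?_
    by_cases hr : (Pi.single r 1 : ι → ℂ) ∈ M
    · simp [hf0 r hr]
    · exact Submodule.smul_mem _ _ (hind r hr)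
  exact this x hx

end Annihilator

/-! ### The weak operator topology and the weak* topology -/

section Topologies

variable {H : Type*} [NormedAddCommGroup H] [InnerProductSpace ℂ H]

lemma continuous_wot_inner [CompleteSpace H] (x y : H) :
    Continuous[wotTopology H, inferInstance] (fun A : H →L[ℂ] H => ⟪x, A y⟫_ℂ) :=
  @Continuous.comp _ _ _ (wotTopology H) _ _ ContinuousLinearMapWOT.ofCLM
    (fun A : H →WOT[ℂ] H => innerSL ℂ x (A y))
    (ContinuousLinearMapWOT.continuous_dual_apply y (innerSL ℂ x)) continuous_induced_dom

lemma continuous_wot_rng [CompleteSpace H] {α : Type*} {t : TopologicalSpace α}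
    {g : α → H →L[ℂ] H} (h : ∀ x y : H, Continuous (fun a => ⟪x, g a y⟫_ℂ)) :
    Continuous[t, wotTopology H] g :=
  continuous_induced_rng.2 (ContinuousLinearMapWOT.continuous_iff.2 fun y x => h x y)

lemma weakStarTopology_le_wotTopology [CompleteSpace H] : weakStarTopology H ≤ wotTopology H := by
  refine continuous_id_iff_le.1 (@continuous_wot_rng H _ _ _ _ (weakStarTopology H) _ fun x y => ?_)
  -- A WOT functional is the weak* functional of two sequences supported at index `0`.
  have h := @Continuous.comp _ _ _ (weakStarTopology H) _ _ _ _
    (continuous_apply ((lp.single 2 0 x : lp (fun _ : ℕ => H) 2),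
      (lp.single 2 0 y : lp (fun _ : ℕ => H) 2))) continuous_induced_dom
  convert h using 1
  ext A
  refine Eq.symm ((tsum_eq_single 0 fun n hn => ?_).trans ?_)
  · simp [hn]
  · simp

lemma continuous_weakStar_inner [CompleteSpace H] (x y : H) :
    Continuous[weakStarTopology H, inferInstance] (fun A : H →L[ℂ] H => ⟪x, A y⟫_ℂ) :=
  continuous_le_dom weakStarTopology_le_wotTopology (continuous_wot_inner x y)

lemma isClosed_weakStar_of_wot [CompleteSpace H] {S : Set (H →L[ℂ] H)}
    (h : IsClosed[wotTopology H] S) : IsClosed[weakStarTopology H] S :=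
  h.mono weakStarTopology_le_wotTopology

lemma continuous_wot_mul_left [CompleteSpace H] (A : H →L[ℂ] H) :
    Continuous[wotTopology H, wotTopology H] (fun B => A * B) := by
  refine @continuous_wot_rng H _ _ _ _ (wotTopology H) _ fun x y => ?_
  convert! continuous_wot_inner (ContinuousLinearMap.adjoint A x) y using 2 with B
  exact (ContinuousLinearMap.adjoint_inner_left A (B y) x).symm

lemma continuous_wot_mul_right [CompleteSpace H] (A : H →L[ℂ] H) :
    Continuous[wotTopology H, wotTopology H] (fun B => B * A) :=
  @continuous_wot_rng H _ _ _ _ (wotTopology H) _ fun x y => continuous_wot_inner x (A y)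

/-- A bounded sequence of operators that converges in the weak operator topology converges in the
weak* topology. -/
lemma tendsto_weakStar_of_bounded {T : ℕ → H →L[ℂ] H} {A : H →L[ℂ] H} {C : ℝ}
    (hC : ∀ N, ‖T N‖ ≤ C)
    (h : ∀ x y : H, Filter.Tendsto (fun N => ⟪x, T N y⟫_ℂ) Filter.atTop (𝓝 ⟪x, A y⟫_ℂ)) :
    Filter.Tendsto T Filter.atTop (@nhds _ (weakStarTopology H) A) := by
  rw [nhds_induced, Filter.tendsto_comap_iff, tendsto_pi_nhds]
  intro p
  refine tendsto_tsum_of_dominated_convergence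
    (bound := fun n => C * (‖p.1 n‖ ^ 2 + ‖p.2 n‖ ^ 2)) ?_ (fun n => h _ _)
    (Filter.Eventually.of_forall fun N n => ?_)
  · have a := (lp.memℓp p.1).summable (by norm_num)
    have b := (lp.memℓp p.2).summable (by norm_num)
    exact Summable.mul_left _ (by simpa using a.add b)
  · have hC0 : 0 ≤ C := (norm_nonneg _).trans (hC N)
    calc ‖⟪p.1 n, T N (p.2 n)⟫_ℂ‖ ≤ ‖p.1 n‖ * (C * ‖p.2 n‖) :=
          (norm_inner_le_norm _ _).trans (mul_le_mul_of_nonneg_left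
            ((T N).le_of_opNorm_le (hC N) _) (norm_nonneg _))
      _ ≤ C * (‖p.1 n‖ ^ 2 + ‖p.2 n‖ ^ 2) := by
          nlinarith [mul_nonneg hC0 (sq_nonneg (‖p.1 n‖ - ‖p.2 n‖)),
            mul_nonneg hC0 (add_nonneg (sq_nonneg ‖p.1 n‖) (sq_nonneg ‖p.2 n‖))]

/-- Bounded sequences of functionals converge to zero as soon as they do so on a set with dense
span. -/
lemma tendsto_zero_of_dense_span {E : Type*} [NormedAddCommGroup E] [NormedSpace ℂ E]
    {φ : ℕ → E → ℂ} {C : ℝ} (hadd : ∀ N x y, φ N (x + y) = φ N x + φ N y)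
    (hsmul : ∀ N (c : ℂ) x, ‖φ N (c • x)‖ = ‖c‖ * ‖φ N x‖)
    (hC : ∀ N x, ‖φ N x‖ ≤ C * ‖x‖) {s : Set E} (hs : Dense (Submodule.span ℂ s : Set E))
    (h : ∀ x ∈ s, Filter.Tendsto (fun N => φ N x) Filter.atTop (𝓝 0)) (x : E) :
    Filter.Tendsto (fun N => φ N x) Filter.atTop (𝓝 0) := by
  have hspan : ∀ x ∈ Submodule.span ℂ s,
      Filter.Tendsto (fun N => φ N x) Filter.atTop (𝓝 0) := by
    intro x hx
    induction hx using Submodule.span_induction with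
    | mem x hx => exact h x hx
    | zero =>
      have : ∀ N, φ N 0 = 0 := fun N => by simpa using hadd N 0 0
      simp [this]
    | add x y _ _ hx hy => simpa [hadd] using hx.add hy
    | smul c x _ hx =>
      rw [tendsto_zero_iff_norm_tendsto_zero] at hx ⊢
      simpa [hsmul] using hx.const_mul ‖c‖
  rw [Metric.tendsto_atTop]
  intro ε hε
  -- `|C| + 1` replaces `C` to have a positive number to divide by.
  have hC' : ∀ N x, ‖φ N x‖ ≤ (|C| + 1) * ‖x‖ := fun N x => (hC N x).trans
    (mul_le_mul_of_nonneg_right ((le_abs_self C).trans (by linarith)) (norm_nonneg _))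
  have hpos : 0 < |C| + 1 := by positivity
  obtain ⟨y, hy, hxy⟩ := Metric.mem_closure_iff.1 (hs x) (ε / 2 / (|C| + 1)) (by positivity)
  obtain ⟨N₀, hN₀⟩ := Metric.tendsto_atTop.1 (hspan y hy) (ε / 2) (by positivity)
  refine ⟨N₀, fun N hN => ?_⟩
  have h1 := hN₀ N hN
  rw [dist_zero_right] at h1 ⊢
  rw [dist_eq_norm, lt_div_iff₀ hpos] at hxy
  have h2 : φ N x = φ N (x - y) + φ N y := by rw [← hadd, sub_add_cancel]
  have h3 := hC' N (x - y)
  rw [h2]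
  linarith [norm_add_le (φ N (x - y)) (φ N y), mul_comm ‖x - y‖ (|C| + 1)]

end Topologies

/-! ### Weak* convergence through matrix entries -/

section Basis

variable {X : Type*}

lemma inner_basisVec_left (x : X) (f : L2 X) : ⟪(basisVec x : L2 X), f⟫_ℂ = f x := by
  classical
  rw [basisVec, lp.inner_single_left]
  simp

lemma dense_span_basisVec :
    Dense (Submodule.span ℂ (Set.range (basisVec : X → L2 X)) : Set (L2 X)) := by
  classical
  intro f
  have h := lp.hasSum_single (p := 2) (by norm_num) f
  refine mem_closure_of_tendsto h (Filter.Eventually.of_forall fun s => ?_)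
  refine Submodule.sum_mem _ fun x _ => ?_
  have : (lp.single 2 x (f x) : L2 X) = f x • basisVec x := by
    rw [basisVec, ← lp.single_smul]
    simp only [smul_eq_mul, mul_one]
  rw [this]
  exact Submodule.smul_mem _ _ (Submodule.subset_span ⟨x, rfl⟩)

lemma ext_matrix {A B : L2 X →L[ℂ] L2 X}
    (h : ∀ u v, A (basisVec v) u = B (basisVec v) u) : A = B :=
  ext_basisVec fun v => by ext u; exact h u v

/-- A bounded sequence of operators on `ℓ²(X)` whose matrix entries converge to those of `A`
converges to `A` in the weak* topology. -/
lemma tendsto_weakStar_of_matrix {T : ℕ → L2 X →L[ℂ] L2 X} {A : L2 X →L[ℂ] L2 X} {C : ℝ}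
    (hC : ∀ N, ‖T N‖ ≤ C)
    (h : ∀ u v, Filter.Tendsto (fun N => T N (basisVec v) u) Filter.atTop
      (𝓝 (A (basisVec v) u))) :
    Filter.Tendsto T Filter.atTop (@nhds _ (weakStarTopology (L2 X)) A) := by
  refine tendsto_weakStar_of_bounded hC fun x y => ?_
  have hD : ∀ N, ‖T N - A‖ ≤ C + ‖A‖ := fun N => (norm_sub_le _ _).trans (by linarith [hC N])
  have hb : ∀ N (x y : L2 X), ‖⟪x, (T N - A) y⟫_ℂ‖ ≤ (C + ‖A‖) * ‖x‖ * ‖y‖ := fun N x y =>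
    (norm_inner_le_norm _ _).trans <| (mul_le_mul_of_nonneg_left
      ((T N - A).le_of_opNorm_le (hD N) _) (norm_nonneg _)).trans_eq (by ring)
  have h1 : ∀ v x, Filter.Tendsto (fun N => ⟪x, (T N - A) (basisVec v)⟫_ℂ) Filter.atTop (𝓝 0) := by
    intro v
    -- The functional is conjugate-linear in this slot, which is why homogeneity is only required in
    -- norm.
    refine tendsto_zero_of_dense_span (C := (C + ‖A‖) * ‖(basisVec v : L2 X)‖)
      (fun N x y => inner_add_left _ _ _) (fun N c x => by
        rw [inner_smul_left, norm_mul, RCLike.norm_conj])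
      (fun N x => (hb N x _).trans_eq (by ring)) dense_span_basisVec ?_
    rintro _ ⟨u, rfl⟩
    simp only [inner_basisVec_left]
    exact tendsto_sub_nhds_zero_iff.2 (h u v)
  have h2 : Filter.Tendsto (fun N => ⟪x, (T N - A) y⟫_ℂ) Filter.atTop (𝓝 0) := by
    refine tendsto_zero_of_dense_span (φ := fun N y => ⟪x, (T N - A) y⟫_ℂ)
      (C := (C + ‖A‖) * ‖x‖) (fun N y z => by rw [map_add, inner_add_right])
      (fun N c y => by rw [map_smul, inner_smul_right, norm_mul])
      (fun N y => hb N x y) dense_span_basisVec ?_ y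
    rintro _ ⟨v, rfl⟩
    exact h1 v x
  refine tendsto_sub_nhds_zero_iff.1 (h2.congr fun N => ?_)
  rw [sub_apply, inner_sub_right]

end Basis

/-! ### Fejér means -/

section Fejer

variable {X : Type*} (deg : X → ℕ)

lemma norm_fibrewise_le {W I : Type*} (e : I × W ≃ X) (A : L2 W →L[ℂ] L2 W) :
    ‖fibrewise e A‖ ≤ ‖A‖ :=
  ContinuousLinearMap.opNorm_le_bound _ (norm_nonneg _) (norm_fibrewiseFun_le e A)

/-- The vector that spreads `ξ_x` over the window `[deg x, deg x + N]`. -/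
def windowVec (N : ℕ) (x : X) : L2 (ℕ × X) :=
  ((Real.sqrt (N + 1))⁻¹ : ℂ) • ∑ j ∈ Finset.Icc (deg x) (deg x + N), basisVec (j, x)

/-- The amplification of `A` preserves the first coordinate, so each position common to the two
windows contributes the same matrix entry of `A`. The overlap ratio is the Fejér weight. -/
lemma inner_windowVec_fibrewise (N : ℕ) (A : L2 X →L[ℂ] L2 X) (x y : X) :
    ⟪windowVec deg N x, fibrewise (Equiv.refl (ℕ × X)) A (windowVec deg N y)⟫_ℂ =
      ((Finset.Icc (deg x) (deg x + N) ∩ Finset.Icc (deg y) (deg y + N)).card / (N + 1) : ℂ) *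
        A (basisVec y) x := by
  classical
  have hs : ((Real.sqrt (N + 1) : ℂ))⁻¹ * ((Real.sqrt (N + 1) : ℂ))⁻¹ = ((N : ℂ) + 1)⁻¹ := by
    rw [← mul_inv, ← Complex.ofReal_mul, Real.mul_self_sqrt (by positivity)]
    push_cast; rfl
  have hm : ∀ j k, ⟪(basisVec (j, x) : L2 (ℕ × X)),
      fibrewise (Equiv.refl (ℕ × X)) A (basisVec (k, y))⟫_ℂ =
        if j = k then A (basisVec y) x else 0 := by
    intro j k
    rw [inner_basisVec_left]
    exact fibrewise_basisVec (Equiv.refl (ℕ × X)) A k j y x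
  simp only [windowVec, map_smul, map_sum, inner_smul_left, inner_smul_right, sum_inner, inner_sum,
    hm, map_inv₀, Complex.conj_ofReal]
  generalize (A (basisVec y) : L2 X) x = m
  rw [← Finset.mul_sum, ← mul_assoc, hs, Finset.sum_comm]
  simp only [Finset.sum_ite_eq, Finset.sum_ite_mem, Finset.sum_const, nsmul_eq_mul]
  ring

lemma orthonormal_windowVec (N : ℕ) : Orthonormal ℂ (windowVec deg N) := by
  classical
  rw [orthonormal_iff_ite]
  intro x y
  -- Orthonormality is the case `A = 1` of the previous computation.
  have h := inner_windowVec_fibrewise deg N 1 x y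
  rw [map_one] at h
  refine h.trans ?_
  rw [one_apply_eq_self, basisVec_apply]
  split_ifs with hxy
  · subst hxy
    rw [Finset.inter_self, Nat.card_Icc]
    have : (deg x + N + 1 - deg x : ℕ) = N + 1 := by omega
    rw [this]
    push_cast
    rw [div_self (by exact_mod_cast Nat.succ_ne_zero N), mul_one]
  · rw [mul_zero]

/-- The isometry that sends `ξ_x` to `windowVec deg N x`. -/
def window (N : ℕ) : L2 X →ₗᵢ[ℂ] L2 (ℕ × X) :=
  (orthonormal_windowVec deg N).orthogonalFamily.linearIsometry

lemma window_basisVec (N : ℕ) (x : X) : window deg N (basisVec x) = windowVec deg N x := by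
  classical
  have h := (orthonormal_windowVec deg N).orthogonalFamily.linearIsometry_apply_single
    (1 : ℂ) (i := x)
  have e : (basisVec x : L2 X) = lp.single 2 x (1 : ℂ) := by
    unfold basisVec; congr
  rw [e]
  refine h.trans ?_
  simp

/-- The `N`-th Fejér mean of an operator on `ℓ²(X)` with respect to a degree function. -/
def fejer (N : ℕ) (A : L2 X →L[ℂ] L2 X) : L2 X →L[ℂ] L2 X :=
  (ContinuousLinearMap.adjoint (window deg N).toContinuousLinearMap).comp
    ((fibrewise (Equiv.refl (ℕ × X)) A).comp (window deg N).toContinuousLinearMap)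

/-- Writing the mean as a compression of an amplification by an isometry makes it contractive,
uniformly in `N`. -/
lemma norm_fejer_le (N : ℕ) (A : L2 X →L[ℂ] L2 X) : ‖fejer deg N A‖ ≤ ‖A‖ := by
  have h1 : ‖(window deg N).toContinuousLinearMap‖ ≤ 1 := (window deg N).norm_toContinuousLinearMap_le
  calc ‖fejer deg N A‖ ≤ ‖ContinuousLinearMap.adjoint (window deg N).toContinuousLinearMap‖ *
        (‖fibrewise (Equiv.refl (ℕ × X)) A‖ * ‖(window deg N).toContinuousLinearMap‖) :=
        (ContinuousLinearMap.opNorm_comp_le _ _).trans (mul_le_mul_of_nonneg_left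
          (ContinuousLinearMap.opNorm_comp_le _ _) (norm_nonneg _))
    _ ≤ 1 * (‖A‖ * 1) := by
        rw [LinearIsometryEquiv.norm_map]
        gcongr
        exact norm_fibrewise_le _ A
    _ = ‖A‖ := by ring

lemma fejer_basisVec (N : ℕ) (A : L2 X →L[ℂ] L2 X) (x y : X) :
    fejer deg N A (basisVec y) x =
      ((Finset.Icc (deg x) (deg x + N) ∩ Finset.Icc (deg y) (deg y + N)).card / (N + 1) : ℂ) *
        A (basisVec y) x := by
  refine (inner_basisVec_left x _).symm.trans (Eq.trans ?_ (inner_windowVec_fibrewise deg N A x y))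
  refine (ContinuousLinearMap.adjoint_inner_right (window deg N).toContinuousLinearMap _ _).trans ?_
  rw [← window_basisVec, ← window_basisVec]
  rfl

/-- Truncated subtraction is correct here: for `k > N` the windows are disjoint. -/
lemma card_window_inter (N m k : ℕ) :
    (Finset.Icc (m + k) (m + k + N) ∩ Finset.Icc m (m + N)).card = N + 1 - k := by
  have : Finset.Icc (m + k) (m + k + N) ∩ Finset.Icc m (m + N) = Finset.Icc (m + k) (m + N) := by
    ext j; simp only [Finset.mem_inter, Finset.mem_Icc]; omega
  rw [this, Nat.card_Icc]
  omega

/-- For a fixed matrix entry the overlap ratio tends to `1`; the uniform norm bound upgrades this to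
weak* convergence. -/
lemma tendsto_fejer (A : L2 X →L[ℂ] L2 X) :
    Filter.Tendsto (fun N => fejer deg N A) Filter.atTop
      (@nhds _ (weakStarTopology (L2 X)) A) := by
  refine tendsto_weakStar_of_matrix (fun N => norm_fejer_le deg N A) fun x y => ?_
  have hcard : ∃ k : ℕ, ∀ N : ℕ,
      (Finset.Icc (deg x) (deg x + N) ∩ Finset.Icc (deg y) (deg y + N)).card = N + 1 - k := by
    rcases le_total (deg x) (deg y) with h | h
    · obtain ⟨k, hk⟩ := Nat.exists_eq_add_of_le h
      exact ⟨k, fun N => by rw [hk, Finset.inter_comm, card_window_inter]⟩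
    · obtain ⟨k, hk⟩ := Nat.exists_eq_add_of_le h
      exact ⟨k, fun N => by rw [hk, card_window_inter]⟩
  obtain ⟨k, hk⟩ := hcard
  have hlim : Filter.Tendsto (fun N : ℕ => (((N + 1 - k : ℕ) : ℂ) / (N + 1))) Filter.atTop
      (𝓝 1) := by
    have h0 : Filter.Tendsto (fun N : ℕ => 1 - (k : ℂ) * (1 / ((N : ℂ) + 1))) Filter.atTop
        (𝓝 (1 - k * 0)) :=
      (tendsto_one_div_add_atTop_nhds_zero_nat.const_mul _).const_sub _
    rw [mul_zero, sub_zero] at h0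
    refine h0.congr' ?_
    filter_upwards [Filter.eventually_ge_atTop k] with N hN
    have hN' : (N : ℂ) + 1 ≠ 0 := by exact_mod_cast Nat.succ_ne_zero N
    rw [Nat.cast_sub (by omega)]
    push_cast
    field_simp
  have := hlim.mul_const (A (basisVec y) x)
  rw [one_mul] at this
  refine this.congr fun N => ?_
  rw [fejer_basisVec, hk]

end Fejer

variable {d : ℕ}

/-! ### Fourier coefficients of operators in the free semigroup algebra -/

/-- The words of length `n`. -/
abbrev WordOfLength (d n : ℕ) : Type := {w : Word d // w.length = n}

instance (n : ℕ) : Finite (WordOfLength d n) := (List.finite_length_eq (Fin d) n).to_subtype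

instance (n : ℕ) : Fintype (WordOfLength d n) := Fintype.ofFinite _

lemma L_mul_L (u v : Word d) : L u * L v = L (u * v) :=
  ext_basisVec fun w => by
    rw [mul_apply_eq_comp, L_basisVec, L_basisVec, L_basisVec, mul_assoc]

lemma L_mem_Lalg (u : Word d) : L u ∈ Lalg d :=
  Algebra.mem_sInf.2 fun _ hS => hS.2 u

lemma isClosed_Lalg : IsClosed[wotTopology (Fock d)] (Lalg d : Set (Fock d →L[ℂ] Fock d)) := by
  rw [Lalg, Algebra.coe_sInf]
  exact @isClosed_biInter _ _ (wotTopology (Fock d)) _ _ fun S hS => hS.1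

lemma Lalg_le {S : Subalgebra ℂ (Fock d →L[ℂ] Fock d)}
    (hS : IsClosed[wotTopology (Fock d)] (S : Set (Fock d →L[ℂ] Fock d)))
    (hL : ∀ u, L u ∈ S) : Lalg d ≤ S :=
  sInf_le ⟨hS, hL⟩

/-- The right translation `ξ_w ↦ ξ_{wv}`. -/
def rightTranslation (v : Word d) : Fock d →ₗᵢ[ℂ] Fock d :=
  (orthonormal_basisVec_comp (mul_left_injective v)).orthogonalFamily.linearIsometry

lemma rightTranslation_basisVec (v w : Word d) :
    rightTranslation v (basisVec w) = basisVec (w * v) := by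
  classical
  have h := (orthonormal_basisVec_comp
    (mul_left_injective v)).orthogonalFamily.linearIsometry_apply_single (1 : ℂ) (i := w)
  have e : (basisVec w : Fock d) = lp.single 2 w (1 : ℂ) := by
    unfold basisVec; congr
  rw [e]
  refine h.trans ?_
  simp

lemma rightTranslation_apply_mul (v w : Word d) (f : Fock d) :
    rightTranslation v f (w * v) = f w := by
  rw [← inner_basisVec_left, ← rightTranslation_basisVec, LinearIsometry.inner_map_map,
    inner_basisVec_left]

lemma rightTranslation_apply_of_notMem {u v : Word d} (h : ∀ w, u ≠ w * v) (f : Fock d) :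
    rightTranslation v f u = 0 := by
  classical
  have h0 : ContinuousLinearMap.adjoint (rightTranslation v).toContinuousLinearMap
      (basisVec u) = 0 := by
    ext w
    rw [← inner_basisVec_left, ContinuousLinearMap.adjoint_inner_right]
    refine (congrArg (fun z => ⟪z, (basisVec u : Fock d)⟫_ℂ)
      (rightTranslation_basisVec v w)).trans ?_
    rw [inner_basisVec_left, basisVec_apply, if_neg (h w).symm]
    rfl
  rw [← inner_basisVec_left]
  refine (ContinuousLinearMap.adjoint_inner_left
    (rightTranslation v).toContinuousLinearMap f (basisVec u)).symm.trans ?_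
  rw [h0, inner_zero_left]

/-- Left multiplications commute with right translations, and a centralizer is WOT-closed, so all of
`𝓛_d` commutes with them. An element of `𝓛_d` is thus determined by its value at the vacuum vector.
-/
lemma apply_basisVec_of_mem_Lalg {A : Fock d →L[ℂ] Fock d} (hA : A ∈ Lalg d) (v : Word d) :
    A (basisVec v) = rightTranslation v (A (basisVec 1)) := by
  let R : Fock d →L[ℂ] Fock d := (rightTranslation v).toContinuousLinearMap
  have hR : ∀ w, R (basisVec w) = basisVec (w * v) := rightTranslation_basisVec v
  have hle : Lalg d ≤ Subalgebra.centralizer ℂ {R} := by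
    refine Lalg_le ?_ fun u => ?_
    · have : (Subalgebra.centralizer ℂ {R} : Set (Fock d →L[ℂ] Fock d)) =
          ⋂ (x : Fock d) (y : Fock d), {A | ⟪x, (R * A) y⟫_ℂ = ⟪x, (A * R) y⟫_ℂ} := by
        ext A
        simp only [SetLike.mem_coe, Subalgebra.mem_centralizer_iff, Set.mem_singleton_iff,
          forall_eq, Set.mem_iInter, Set.mem_ofPred_eq]
        exact ⟨fun h x y => by rw [h], fun h => ContinuousLinearMap.ext fun y =>
          ext_inner_left ℂ fun x => h x y⟩
      rw [this]
      refine @isClosed_iInter _ _ (wotTopology (Fock d)) _ fun x =>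
        @isClosed_iInter _ _ (wotTopology (Fock d)) _ fun y => ?_
      exact @isClosed_eq _ _ _ (wotTopology (Fock d)) _ _ _
        (@Continuous.comp _ _ _ (wotTopology (Fock d)) (wotTopology (Fock d)) _ _ _
          (continuous_wot_inner x y) (continuous_wot_mul_left R))
        (@Continuous.comp _ _ _ (wotTopology (Fock d)) (wotTopology (Fock d)) _ _ _
          (continuous_wot_inner x y) (continuous_wot_mul_right R))
    · rw [Subalgebra.mem_centralizer_iff]
      rintro _ rfl
      refine ext_basisVec fun w => ?_
      simp only [mul_apply_eq_comp, L_basisVec, hR, mul_assoc]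
  have h := Subalgebra.mem_centralizer_iff ℂ |>.1 (hle hA) R rfl
  have h2 := DFunLike.congr_fun h (basisVec 1)
  simp only [mul_apply_eq_comp, hR, one_mul] at h2
  exact h2.symm

/-- The Fourier coefficients of degree `n` of an operator on the Fock space. -/
def coeffs (d n : ℕ) : (Fock d →L[ℂ] Fock d) →ₗ[ℂ] (WordOfLength d n → ℂ) where
  toFun A w := A (basisVec 1) w
  map_add' A B := by ext w; rfl
  map_smul' c A := by ext w; rfl

@[simp] lemma coeffs_apply (n : ℕ) (A : Fock d →L[ℂ] Fock d) (w : WordOfLength d n) :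
    coeffs d n A w = A (basisVec 1) w := rfl

/-- The homogeneous operator with given Fourier coefficients. -/
def ofCoeffs (d n : ℕ) : (WordOfLength d n → ℂ) →ₗ[ℂ] (Fock d →L[ℂ] Fock d) :=
  Fintype.linearCombination ℂ (fun w : WordOfLength d n => L (w : Word d))

lemma ofCoeffs_apply (n : ℕ) (x : WordOfLength d n → ℂ) :
    ofCoeffs d n x = ∑ w, x w • L (w : Word d) := rfl

lemma ofCoeffs_single (n : ℕ) [DecidableEq (WordOfLength d n)] (w : WordOfLength d n) :
    ofCoeffs d n (Pi.single w 1) = L (w : Word d) := by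
  rw [ofCoeffs, Fintype.linearCombination_apply_single, one_smul]

lemma ofCoeffs_basisVec (n : ℕ) (x : WordOfLength d n → ℂ) (u v : Word d) :
    ofCoeffs d n x (basisVec v) u = ∑ w, x w * (basisVec ((w : Word d) * v) : Fock d) u := by
  rw [ofCoeffs_apply, sum_apply, lp.coeFn_sum, Finset.sum_apply]
  refine Finset.sum_congr rfl fun w _ => ?_
  rw [smul_apply, L_basisVec]
  rfl

lemma ofCoeffs_basisVec_mul (n : ℕ) (x : WordOfLength d n → ℂ) (w v : Word d) :
    ofCoeffs d n x (basisVec v) (w * v) = if h : w.length = n then x ⟨w, h⟩ else 0 := by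
  classical
  rw [ofCoeffs_basisVec]
  simp only [basisVec_apply, mul_left_inj, mul_ite, mul_one, mul_zero]
  split_ifs with h
  · rw [Finset.sum_eq_single ⟨w, h⟩]
    · simp
    · intro b _ hb
      exact if_neg fun hwb => hb (Subtype.ext hwb.symm)
    · simp
  · exact Finset.sum_eq_zero fun b _ => if_neg fun hwb => h (by rw [hwb]; exact b.2)

lemma ofCoeffs_basisVec_of_notMem (n : ℕ) (x : WordOfLength d n → ℂ) {u v : Word d}
    (h : ∀ w, u ≠ w * v) : ofCoeffs d n x (basisVec v) u = 0 := by
  classical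
  rw [ofCoeffs_basisVec]
  refine Finset.sum_eq_zero fun b _ => ?_
  rw [basisVec_apply, if_neg (h b), mul_zero]

lemma coeffs_ofCoeffs (n : ℕ) (x : WordOfLength d n → ℂ) : coeffs d n (ofCoeffs d n x) = x := by
  ext w
  have := ofCoeffs_basisVec_mul n x w 1
  rw [mul_one, dif_pos w.2] at this
  exact this

lemma continuous_coeffs (n : ℕ) :
    Continuous[wotTopology (Fock d), inferInstance] (coeffs d n) := by
  refine @continuous_pi _ _ _ (wotTopology (Fock d)) _ _ fun w => ?_
  have := continuous_wot_inner (basisVec (w : Word d) : Fock d) (basisVec 1)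
  exact (funext fun A : Fock d →L[ℂ] Fock d => inner_basisVec_left (w : Word d) (A (basisVec 1))) ▸ this

/-- The projection onto the homogeneous part of degree `n`. -/
def homogProj (d n : ℕ) : (Fock d →L[ℂ] Fock d) →ₗ[ℂ] (Fock d →L[ℂ] Fock d) :=
  ofCoeffs d n ∘ₗ coeffs d n

lemma homogProj_apply (n : ℕ) (A : Fock d →L[ℂ] Fock d) :
    homogProj d n A = ofCoeffs d n (coeffs d n A) := rfl

lemma homogProj_L (n : ℕ) (w : Word d) :
    homogProj d n (L w) = if w.length = n then L w else 0 := by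
  classical
  have hc : ∀ u : WordOfLength d n, coeffs d n (L w) u = if (u : Word d) = w then 1 else 0 := by
    intro u
    rw [coeffs_apply, L_basisVec, mul_one, basisVec_apply]
  rw [homogProj_apply]
  split_ifs with h
  · have : coeffs d n (L w) = Pi.single ⟨w, h⟩ 1 := by
      ext u
      rw [hc, Pi.single_apply]
      simp [Subtype.ext_iff]
    rw [this, ofCoeffs_single]
  · have : coeffs d n (L w) = 0 := by
      ext u
      rw [hc, if_neg fun hu => h (by rw [← hu]; exact u.2)]
      rfl
    rw [this, map_zero]

lemma homogProj_of_mem {m : ℕ} {A : Fock d →L[ℂ] Fock d} (hA : A ∈ homogeneousPart d m) (n : ℕ) :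
    homogProj d n A = if m = n then A else 0 := by
  induction hA using Submodule.span_induction with
  | mem A hA =>
    obtain ⟨w, rfl, rfl⟩ := hA
    exact homogProj_L n w
  | zero => simp
  | add A B _ _ hA hB => rw [map_add, hA, hB]; split_ifs <;> simp
  | smul c A _ hA => rw [map_smul, hA]; split_ifs <;> simp

/-- The projection factors through the finite-dimensional space of coefficients of degree `n`, where
every subspace is closed; no closedness of `K` is needed. -/
lemma isClosed_homogProj_mem (K : Submodule ℂ (Fock d →L[ℂ] Fock d)) (n : ℕ) :
    IsClosed[wotTopology (Fock d)] {A | homogProj d n A ∈ K} :=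
  @IsClosed.preimage _ _ (wotTopology (Fock d)) _ _ (continuous_coeffs n) _
    (Submodule.closed_of_finiteDimensional (K.comap (ofCoeffs d n)))

/-- For `A` in `𝓛_d`, a nonzero entry in column `v` sits in a row `w * v`, and its weight depends
only on the degree difference `w.length`. The mean is therefore a finite combination of homogeneous
components. -/
lemma fejer_eq_sum {A : Fock d →L[ℂ] Fock d} (hA : A ∈ Lalg d) (N : ℕ) :
    fejer (fun w : Word d => w.length) N A =
      ∑ n ∈ Finset.range (N + 1), (((N + 1 - n : ℕ) : ℂ) / (N + 1)) • homogProj d n A := by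
  refine ext_matrix fun u v => ?_
  rw [fejer_basisVec, apply_basisVec_of_mem_Lalg hA v, sum_apply, lp.coeFn_sum,
    Finset.sum_apply]
  have hterm : ∀ n, ((((N + 1 - n : ℕ) : ℂ) / (N + 1)) • homogProj d n A) (basisVec v) u =
      (((N + 1 - n : ℕ) : ℂ) / (N + 1)) * ofCoeffs d n (coeffs d n A) (basisVec v) u :=
    fun n => rfl
  simp only [hterm]
  by_cases hu : ∃ w, u = w * v
  · obtain ⟨w, rfl⟩ := hu
    have hc : (Finset.Icc (w * v).length ((w * v).length + N) ∩
        Finset.Icc v.length (v.length + N)).card = N + 1 - w.length := by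
      rw [FreeMonoid.length_mul, add_comm w.length, card_window_inter]
    rw [hc, rightTranslation_apply_mul]
    simp only [ofCoeffs_basisVec_mul, coeffs_apply]
    by_cases hw : w.length < N + 1
    · rw [Finset.sum_eq_single_of_mem w.length (Finset.mem_range.2 hw)]
      · simp
      · intro n _ hn
        rw [dif_neg (Ne.symm hn), mul_zero]
    -- Degrees above `N` have weight zero on the left and are absent from the sum.
    · have h0 : N + 1 - w.length = 0 := by omega
      rw [h0, Nat.cast_zero, zero_div, zero_mul]
      refine (Finset.sum_eq_zero fun n hn => ?_).symm
      rw [dif_neg, mul_zero]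
      have := Finset.mem_range.1 hn
      omega
  · have hu' : ∀ w, u ≠ w * v := fun w h => hu ⟨w, h⟩
    rw [rightTranslation_apply_of_notMem hu', mul_zero]
    refine (Finset.sum_eq_zero fun n _ => ?_).symm
    rw [ofCoeffs_basisVec_of_notMem n _ hu', mul_zero]

/-- An element of `𝓛_d` lies in the weak*-closure of every subspace that contains all its
homogeneous components. -/
lemma mem_closure_of_homogProj_mem {A : Fock d →L[ℂ] Fock d} (hA : A ∈ Lalg d)
    {K : Submodule ℂ (Fock d →L[ℂ] Fock d)} (h : ∀ n, homogProj d n A ∈ K) :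
    A ∈ closure[weakStarTopology (Fock d)] (K : Set (Fock d →L[ℂ] Fock d)) := by
  let _ := weakStarTopology (Fock d)
  refine mem_closure_of_tendsto
    (tendsto_fejer (fun w : Word d => w.length) A) (Filter.Eventually.of_forall fun N => ?_)
  rw [fejer_eq_sum hA]
  exact Submodule.sum_mem _ fun n _ => Submodule.smul_mem _ _ (h n)

/-- The weak*-closure of a graded subspace `K` of `𝓛_d` consists of the elements of `𝓛_d` whose
homogeneous components lie in `K`. -/
lemma closure_eq_setOf_homogProj_mem {K : Submodule ℂ (Fock d →L[ℂ] Fock d)}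
    (hK : ∀ A ∈ K, A ∈ Lalg d) (hgr : ∀ A ∈ K, ∀ n, homogProj d n A ∈ K) :
    closure[weakStarTopology (Fock d)] (K : Set (Fock d →L[ℂ] Fock d)) =
      {A | A ∈ Lalg d ∧ ∀ n, homogProj d n A ∈ K} ∧
    IsClosed[wotTopology (Fock d)] {A | A ∈ Lalg d ∧ ∀ n, homogProj d n A ∈ K} := by
  have hcl : IsClosed[wotTopology (Fock d)] {A | A ∈ Lalg d ∧ ∀ n, homogProj d n A ∈ K} := by
    have : {A | A ∈ Lalg d ∧ ∀ n, homogProj d n A ∈ K} =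
        (Lalg d : Set (Fock d →L[ℂ] Fock d)) ∩ ⋂ n, {A | homogProj d n A ∈ K} := by
      ext A; simp
    rw [this]
    exact @IsClosed.inter _ _ _ (wotTopology (Fock d)) isClosed_Lalg
      (@isClosed_iInter _ _ (wotTopology (Fock d)) _ fun n => isClosed_homogProj_mem K n)
  refine ⟨Set.Subset.antisymm ?_ fun A hA => mem_closure_of_homogProj_mem hA.1 hA.2, hcl⟩
  let _ := weakStarTopology (Fock d)
  exact closure_minimal (fun A hA => ⟨hK A hA, hgr A hA⟩) (isClosed_weakStar_of_wot hcl)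

/-! ### The operators `L_u` on the semigroup with zero -/

lemma L0_mul (u v : Word0 d) : L0 (u * v) = L0 u * L0 v := by
  induction u using WithZero.recZeroCoe with
  | zero => simp
  | coe u =>
    induction v using WithZero.recZeroCoe with
    | zero => simp
    | coe v => rw [← WithZero.coe_mul, L0_coe, L0_coe, L0_coe, L_mul_L]

lemma L0_mem_Lalg (u : Word0 d) : L0 u ∈ Lalg d := by
  induction u using WithZero.recZeroCoe with
  | zero => exact zero_mem _
  | coe u => exact L_mem_Lalg u

/-- The span of the differences `L_u - L_v` with `u ∼ v`. -/
def conSpan (c : Con (Word0 d)) : Submodule ℂ (Fock d →L[ℂ] Fock d) :=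
  Submodule.span ℂ {T | ∃ u v : Word0 d, c u v ∧ T = L0 u - L0 v}

lemma sub_mem_conSpan {c : Con (Word0 d)} {u v : Word0 d} (h : c u v) :
    L0 u - L0 v ∈ conSpan c :=
  Submodule.subset_span ⟨u, v, h, rfl⟩

lemma mem_conSpan_of_zero {c : Con (Word0 d)} {u : Word0 d} (h : c u 0) : L0 u ∈ conSpan c := by
  simpa using sub_mem_conSpan h

lemma conSpan_le_Lalg (c : Con (Word0 d)) {A : Fock d →L[ℂ] Fock d} (hA : A ∈ conSpan c) :
    A ∈ Lalg d := by
  have : conSpan c ≤ Subalgebra.toSubmodule (Lalg d) := by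
    refine Submodule.span_le.2 ?_
    rintro _ ⟨u, v, _, rfl⟩
    exact sub_mem (L0_mem_Lalg u) (L0_mem_Lalg v)
  exact this hA

/-- The differences `L_u - L_v` with `u ∼ v` that are homogeneous span all of them. -/
lemma conSpan_le {c : Con (Word0 d)} (hc : IsHomogeneousCon c)
    {K : Submodule ℂ (Fock d →L[ℂ] Fock d)}
    (h0 : ∀ w : Word d, c w 0 → L w ∈ K)
    (h : ∀ u v : Word d, c u v → u.length = v.length → L u - L v ∈ K) : conSpan c ≤ K := by
  refine Submodule.span_le.2 ?_
  have h0' : ∀ u : Word0 d, c u 0 → L0 u ∈ K := by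
    intro u hu
    induction u using WithZero.recZeroCoe with
    | zero => exact zero_mem _
    | coe w => exact h0 w hu
  rintro _ ⟨u, v, huv, rfl⟩
  by_cases hu : c u 0
  · exact sub_mem (h0' u hu) (h0' v (c.trans (c.symm huv) hu))
  · induction u using WithZero.recZeroCoe with
    | zero => exact absurd (c.refl 0) hu
    | coe u =>
      induction v using WithZero.recZeroCoe with
      | zero => exact absurd huv hu
      | coe v => exact h u v huv (hc u v huv hu)

lemma homogProj_mem_conSpan {c : Con (Word0 d)} (hc : IsHomogeneousCon c)
    {A : Fock d →L[ℂ] Fock d} (hA : A ∈ conSpan c) (n : ℕ) : homogProj d n A ∈ conSpan c := by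
  have : conSpan c ≤ (conSpan c).comap (homogProj d n) := by
    refine conSpan_le hc (fun w hw => ?_) fun u v huv hlen => ?_
    · rw [Submodule.mem_comap, homogProj_L]
      split_ifs
      · exact mem_conSpan_of_zero hw
      · exact zero_mem _
    · rw [Submodule.mem_comap, map_sub, homogProj_L, homogProj_L, hlen]
      split_ifs
      · exact sub_mem_conSpan huv
      · rw [sub_zero]; exact zero_mem _
  exact this hA

lemma L_mul_mem_conSpan {c : Con (Word0 d)} (w : Word d) {A : Fock d →L[ℂ] Fock d}
    (hA : A ∈ conSpan c) : L w * A ∈ conSpan c := by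
  have : conSpan c ≤ (conSpan c).comap (LinearMap.mulLeft ℂ (L w)) := by
    refine Submodule.span_le.2 ?_
    rintro _ ⟨u, v, huv, rfl⟩
    rw [SetLike.mem_coe, Submodule.mem_comap, LinearMap.mulLeft_apply, mul_sub, ← L0_coe,
      ← L0_mul, ← L0_mul]
    exact sub_mem_conSpan (c.mul (c.refl _) huv)
  exact this hA

lemma mul_L_mem_conSpan {c : Con (Word0 d)} (w : Word d) {A : Fock d →L[ℂ] Fock d}
    (hA : A ∈ conSpan c) : A * L w ∈ conSpan c := by
  have : conSpan c ≤ (conSpan c).comap (LinearMap.mulRight ℂ (L w)) := by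
    refine Submodule.span_le.2 ?_
    rintro _ ⟨u, v, huv, rfl⟩
    rw [SetLike.mem_coe, Submodule.mem_comap, LinearMap.mulRight_apply, sub_mul, ← L0_coe,
      ← L0_mul, ← L0_mul]
    exact sub_mem_conSpan (c.mul huv (c.refl _))
  exact this hA

/-- A WOT-closed subspace of `𝓛_d` that is invariant under left and right multiplication by the
generators is an ideal. -/
lemma isIdeal_of_L_mul_mem {J : Submodule ℂ (Fock d →L[ℂ] Fock d)}
    (hJ : (J : Set (Fock d →L[ℂ] Fock d)) ⊆ Lalg d)
    (hcl : IsClosed[wotTopology (Fock d)] (J : Set (Fock d →L[ℂ] Fock d)))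
    (hl : ∀ w, ∀ A ∈ J, L w * A ∈ J) (hr : ∀ w, ∀ A ∈ J, A * L w ∈ J) :
    IsIdeal (J : Set (Fock d →L[ℂ] Fock d)) := by
  -- The left and right multipliers of `J` form algebras that are WOT-closed by separate continuity
  -- of multiplication. Containing the generators, they contain `𝓛_d`.
  let Sl : Subalgebra ℂ (Fock d →L[ℂ] Fock d) :=
    { carrier := {A | ∀ B ∈ J, A * B ∈ J}
      mul_mem' := fun {A A'} hA hA' B hB => by rw [mul_assoc]; exact hA _ (hA' B hB)
      add_mem' := fun {A A'} hA hA' B hB => by rw [add_mul]; exact J.add_mem (hA B hB) (hA' B hB)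
      algebraMap_mem' := fun c B hB => by
        rw [← Algebra.smul_def]; exact J.smul_mem c hB }
  let Sr : Subalgebra ℂ (Fock d →L[ℂ] Fock d) :=
    { carrier := {A | ∀ B ∈ J, B * A ∈ J}
      mul_mem' := fun {A A'} hA hA' B hB => by rw [← mul_assoc]; exact hA' _ (hA B hB)
      add_mem' := fun {A A'} hA hA' B hB => by rw [mul_add]; exact J.add_mem (hA B hB) (hA' B hB)
      algebraMap_mem' := fun c B hB => by
        rw [← Algebra.commutes, ← Algebra.smul_def]; exact J.smul_mem c hB }
  have hSl : Lalg d ≤ Sl := by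
    refine Lalg_le ?_ hl
    have : (Sl : Set (Fock d →L[ℂ] Fock d)) = ⋂ B ∈ J, (fun A => A * B) ⁻¹' J := by
      ext A; simp [Sl]
    rw [this]
    exact @isClosed_biInter _ _ (wotTopology (Fock d)) _ _ fun B _ =>
      @IsClosed.preimage _ _ (wotTopology (Fock d)) (wotTopology (Fock d)) _
        (continuous_wot_mul_right B) _ hcl
  have hSr : Lalg d ≤ Sr := by
    refine Lalg_le ?_ hr
    have : (Sr : Set (Fock d →L[ℂ] Fock d)) = ⋂ B ∈ J, (fun A => B * A) ⁻¹' J := by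
      ext A; simp [Sr]
    rw [this]
    exact @isClosed_biInter _ _ (wotTopology (Fock d)) _ _ fun B _ =>
      @IsClosed.preimage _ _ (wotTopology (Fock d)) (wotTopology (Fock d)) _
        (continuous_wot_mul_left B) _ hcl
  exact
    { subset := hJ
      zero_mem := J.zero_mem
      add_mem := fun A hA B hB => J.add_mem hA hB
      mul_mem_left := fun A hA B hB => hSl hA B hB
      mul_mem_right := fun A hA B hB => hSr hB A hA
      closed := hcl }

/-! ### The weak*-closed span of a homogeneous congruence -/

lemma weakStarSpan_mono {H : Type*} [NormedAddCommGroup H] [InnerProductSpace ℂ H]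
    {S T : Set (H →L[ℂ] H)} (h : Submodule.span ℂ S ≤ Submodule.span ℂ T) :
    weakStarSpan S ⊆ weakStarSpan T :=
  @closure_mono _ (weakStarTopology H) _ _ h

lemma weakStarSpan_subset {H : Type*} [NormedAddCommGroup H] [InnerProductSpace ℂ H]
    {S : Set (H →L[ℂ] H)} {J : Submodule ℂ (H →L[ℂ] H)}
    (hJ : IsClosed[weakStarTopology H] (J : Set (H →L[ℂ] H))) (h : S ⊆ J) :
    weakStarSpan S ⊆ J := by
  let _ := weakStarTopology H
  exact closure_minimal (Submodule.span_le.2 h) hJ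

/-- The elements of `𝓛_d` all of whose homogeneous components lie in `conSpan c`. -/
def conIdeal (c : Con (Word0 d)) : Submodule ℂ (Fock d →L[ℂ] Fock d) where
  carrier := {A | A ∈ Lalg d ∧ ∀ n, homogProj d n A ∈ conSpan c}
  zero_mem' := ⟨zero_mem _, fun n => by rw [map_zero]; exact zero_mem _⟩
  add_mem' := fun hA hB => ⟨add_mem hA.1 hB.1, fun n => by
    rw [map_add]; exact add_mem (hA.2 n) (hB.2 n)⟩
  smul_mem' := fun a A hA => ⟨Subalgebra.smul_mem _ hA.1 a, fun n => by
    rw [map_smul]; exact Submodule.smul_mem _ a (hA.2 n)⟩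

lemma comul_L0 (u : Word0 d) : comul d (L0 u) = tensor (L0 u) (L0 u) := by
  induction u using WithZero.recZeroCoe with
  | zero => simp [tensor]
  | coe u => exact comul_L u

lemma tensor_sub_left (A B C : Fock d →L[ℂ] Fock d) :
    tensor (A - B) C = tensor A C - tensor B C := by
  simp [tensor, sub_mul]

lemma tensor_sub_right (A B C : Fock d →L[ℂ] Fock d) :
    tensor A (B - C) = tensor A B - tensor A C := by
  simp [tensor, mul_sub]

theorem isHomogeneousHopfIdeal_of_con {c : Con (Word0 d)} (hc : IsHomogeneousCon c) :
    IsHomogeneousHopfIdeal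
      (weakStarSpan {T | ∃ u v : Word0 d, c u v ∧ T = L0 u - L0 v}) := by
  obtain ⟨heq, hcl⟩ := closure_eq_setOf_homogProj_mem (K := conSpan c)
    (fun A hA => conSpan_le_Lalg c hA) (fun A hA n => homogProj_mem_conSpan hc hA n)
  have hJ : weakStarSpan {T | ∃ u v : Word0 d, c u v ∧ T = L0 u - L0 v} =
      (conIdeal c : Set (Fock d →L[ℂ] Fock d)) := heq
  have hcl : IsClosed[wotTopology (Fock d)] (conIdeal c : Set (Fock d →L[ℂ] Fock d)) := hcl
  have hsub : (conIdeal c : Set (Fock d →L[ℂ] Fock d)) ⊆ Lalg d := fun A hA => hA.1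
  have hle : conSpan c ≤ conIdeal c := fun A hA =>
    ⟨conSpan_le_Lalg c hA, fun n => homogProj_mem_conSpan hc hA n⟩
  -- WOT-continuous maps extend invariance from the span to its closure, since `conIdeal c` is
  -- itself WOT-closed.
  have hdense : ∀ F : (Fock d →L[ℂ] Fock d) → (Fock d →L[ℂ] Fock d),
      Continuous[wotTopology (Fock d), wotTopology (Fock d)] F →
      (∀ A ∈ conSpan c, F A ∈ conIdeal c) → ∀ A ∈ conIdeal c, F A ∈ conIdeal c := by
    intro F hF h A hA
    have hA' : A ∈ weakStarSpan {T | ∃ u v : Word0 d, c u v ∧ T = L0 u - L0 v} := hJ ▸ hA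
    have hclF := isClosed_weakStar_of_wot
      (@IsClosed.preimage _ _ (wotTopology (Fock d)) (wotTopology (Fock d)) _ hF _ hcl)
    let _ := weakStarTopology (Fock d)
    exact closure_minimal (s := (conSpan c : Set (Fock d →L[ℂ] Fock d))) h hclF hA'
  rw [hJ]
  refine ⟨isIdeal_of_L_mul_mem hsub hcl (fun w => hdense _ (continuous_wot_mul_left (L w)) ?_)
    (fun w => hdense _ (continuous_wot_mul_right (L w)) ?_), ?_, ?_⟩
  · exact fun A hA => hle (L_mul_mem_conSpan w hA)
  · exact fun A hA => hle (mul_L_mem_conSpan w hA)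
  · refine ⟨hsub, zero_mem _, fun A hA B hB => add_mem hA hB,
      fun a A hA => Submodule.smul_mem _ a hA, isClosed_weakStar_of_wot hcl, ?_⟩
    intro A hA
    set G : Set (Fock2 d →L[ℂ] Fock2 d) :=
      {T | ∃ A ∈ (conIdeal c : Set (Fock d →L[ℂ] Fock d)), ∃ B ∈ Lalg d, T = tensor A B} ∪
        {T | ∃ A ∈ Lalg d, ∃ B ∈ (conIdeal c : Set (Fock d →L[ℂ] Fock d)), T = tensor A B}
    have hA' : A ∈ weakStarSpan {T | ∃ u v : Word0 d, c u v ∧ T = L0 u - L0 v} := hJ ▸ hA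
    have hmap : conSpan c ≤ (Submodule.span ℂ G).comap (comul d).toLinearMap := by
      refine Submodule.span_le.2 ?_
      rintro _ ⟨u, v, huv, rfl⟩
      have huv' : L0 u - L0 v ∈ (conIdeal c : Set (Fock d →L[ℂ] Fock d)) :=
        hle (sub_mem_conSpan huv)
      -- Both `L0 u` and `L0 v` are group-like (or zero), so the difference is skew-primitive.
      have hsplit : comul d (L0 u - L0 v) =
          tensor (L0 u - L0 v) (L0 u) + tensor (L0 v) (L0 u - L0 v) := by
        rw [map_sub, comul_L0, comul_L0, tensor_sub_left, tensor_sub_right]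
        abel
      change comul d (L0 u - L0 v) ∈ Submodule.span ℂ G
      rw [hsplit]
      exact add_mem
        (Submodule.subset_span (Or.inl ⟨_, huv', _, L0_mem_Lalg u, rfl⟩))
        (Submodule.subset_span (Or.inr ⟨_, L0_mem_Lalg v, _, huv', rfl⟩))
    exact @map_mem_closure _ _ (weakStarTopology (Fock d)) (weakStarTopology (Fock2 d)) _ _ _ _
      continuous_comul hA' hmap
  · refine Set.Subset.antisymm ?_
      (weakStarSpan_subset (isClosed_weakStar_of_wot hcl) fun A hA => hA.1)
    rw [← hJ]
    refine weakStarSpan_mono ?_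
    -- Homogeneity of the congruence lets the span be generated by the `L w` with `w ∼ 0` and by
    -- differences of words of equal length.
    refine conSpan_le hc (fun w hw => Submodule.subset_span ⟨?_, w.length, ?_⟩)
      fun u v huv hlen => Submodule.subset_span ⟨?_, u.length, ?_⟩
    · rw [hJ]; exact hle (mem_conSpan_of_zero hw)
    · exact Submodule.subset_span ⟨w, rfl, rfl⟩
    · rw [hJ]; exact hle (sub_mem_conSpan huv)
    · exact sub_mem (Submodule.subset_span ⟨u, rfl, rfl⟩)
        (Submodule.subset_span ⟨v, hlen.symm, rfl⟩)

/-! ### The congruence of a homogeneous Hopf ideal -/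

/-- The fibre through `(1, 1)` is the diagonal, on which `Δ(A)` acts as `A`. -/
lemma comul_basisVec_one_one (A : Fock d →L[ℂ] Fock d) (u v : Word d) [Decidable (u = v)] :
    comul d A (basisVec (1, 1)) (u, v) = if u = v then A (basisVec 1) u else 0 := by
  classical
  have h1 : ((1, 1) : Word d × Word d) ∈ Prefixless d := by
    intro i a b h
    have := congrArg (fun p : Word d × Word d => p.1.length) h
    simp [FreeMonoid.length_mul] at this
    omega
  have h11 : ∀ g : Word d, prefixEquiv d (⟨(1, 1), h1⟩, g) = (g, g) := fun g => by
    simp [prefixEquiv]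
  obtain ⟨⟨q, g⟩, hq⟩ := (prefixEquiv d).surjective (u, v)
  have hfib := fibrewise_basisVec (prefixEquiv d) A ⟨(1, 1), h1⟩ q 1 g
  rw [h11, hq] at hfib
  refine hfib.trans ?_
  by_cases huv : u = v
  · subst huv
    obtain ⟨rfl, rfl⟩ := Prod.mk.inj ((prefixEquiv d).injective (hq.trans (h11 u).symm))
    simp
  · rw [if_neg huv, if_neg]
    rintro rfl
    rw [h11] at hq
    exact huv ((Prod.mk.inj hq).1.symm.trans (Prod.mk.inj hq).2)

/-- The subspace underlying a coideal. -/
def IsCoideal.toSubmodule {J : Set (Fock d →L[ℂ] Fock d)} (hJ : IsCoideal J) :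
    Submodule ℂ (Fock d →L[ℂ] Fock d) where
  carrier := J
  zero_mem' := hJ.zero_mem
  add_mem' := fun {A B} hA hB => hJ.add_mem A hA B hB
  smul_mem' := fun c A hA => hJ.smul_mem c A hA

/-- The operators whose degree `n` component lies in `J` form a weak*-closed subspace containing the
homogeneous elements of `J`, whose closed span is `J`. -/
lemma IsHomogeneousHopfIdeal.homogProj_mem {J : Set (Fock d →L[ℂ] Fock d)}
    (hJ : IsHomogeneousHopfIdeal J) {A : Fock d →L[ℂ] Fock d} (hA : A ∈ J) (n : ℕ) :
    homogProj d n A ∈ J := by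
  have hcl := isClosed_weakStar_of_wot (isClosed_homogProj_mem hJ.isCoideal.toSubmodule n)
  have hsub := weakStarSpan_subset (J := hJ.isCoideal.toSubmodule.comap (homogProj d n))
    (S := {A | A ∈ J ∧ ∃ n, A ∈ homogeneousPart d n}) hcl (by
      rintro B ⟨hB, m, hm⟩
      change homogProj d n B ∈ J
      rw [homogProj_of_mem hm]
      split_ifs
      · exact hB
      · exact hJ.isCoideal.zero_mem)
  exact hsub (hJ.isHomogeneous ▸ hA)

lemma continuous_weakStar_entry {X : Type*} (x y : X) :
    Continuous[weakStarTopology (L2 X), inferInstance]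
      (fun T : L2 X →L[ℂ] L2 X => T (basisVec y) x) :=
  (funext fun T : L2 X →L[ℂ] L2 X => inner_basisVec_left x (T (basisVec y))) ▸
    continuous_weakStar_inner (basisVec x : L2 X) (basisVec y)

/-- The pairing of an operator on `ℓ²(𝔽_d^* × 𝔽_d^*)` with the coefficient functional `f ⊗ g`. -/
def pairing {n : ℕ} (f g : WordOfLength d n → ℂ) : (Fock2 d →L[ℂ] Fock2 d) →ₗ[ℂ] ℂ where
  toFun T := ∑ p : WordOfLength d n × WordOfLength d n,
    f p.1 * g p.2 * T (basisVec (1, 1)) ((p.1 : Word d), (p.2 : Word d))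
  map_add' S T := by
    rw [← Finset.sum_add_distrib]
    exact Finset.sum_congr rfl fun p _ => mul_add _ _ _
  map_smul' c T := by
    rw [smul_eq_mul, Finset.mul_sum]
    exact Finset.sum_congr rfl fun p _ => mul_left_comm _ _ _

lemma continuous_pairing {n : ℕ} (f g : WordOfLength d n → ℂ) :
    Continuous[weakStarTopology (Fock2 d), inferInstance] (pairing f g) := by
  let _ := weakStarTopology (Fock2 d)
  exact continuous_finsetSum _ fun p _ => (continuous_weakStar_entry _ _).const_mul _

lemma pairing_tensor {n : ℕ} (f g : WordOfLength d n → ℂ) (A B : Fock d →L[ℂ] Fock d) :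
    pairing f g (tensor A B) = (∑ u, f u * coeffs d n A u) * ∑ v, g v * coeffs d n B v := by
  change ∑ p : WordOfLength d n × WordOfLength d n, _ = _
  rw [Fintype.sum_prod_type, Finset.sum_mul_sum]
  refine Finset.sum_congr rfl fun u _ => Finset.sum_congr rfl fun v _ => ?_
  rw [tensor_basisVec, coeffs_apply, coeffs_apply]
  ring

/-- Only the diagonal contributes, so the transpose of `Δ` is the pointwise product. -/
lemma pairing_comul {n : ℕ} (f g : WordOfLength d n → ℂ) (A : Fock d →L[ℂ] Fock d) :
    pairing f g (comul d A) = ∑ u, (f * g) u * coeffs d n A u := by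
  classical
  change ∑ p : WordOfLength d n × WordOfLength d n, _ = _
  rw [Fintype.sum_prod_type]
  refine Finset.sum_congr rfl fun u _ => ?_
  rw [Finset.sum_eq_single u]
  · rw [comul_basisVec_one_one, if_pos rfl]; rfl
  · intro v _ hv
    rw [comul_basisVec_one_one, if_neg fun h => hv (Subtype.ext h.symm), mul_zero]
  · simp

/-- The functional `f ⊗ g` kills `J ⊗ 𝓛_d` through `f` and `𝓛_d ⊗ J` through `g`. By
weak*-continuity it kills `Δ(J)`, on which it is the pairing with `f * g`. -/
lemma IsHomogeneousHopfIdeal.mul_mem_annihilator {J : Set (Fock d →L[ℂ] Fock d)}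
    (hJ : IsHomogeneousHopfIdeal J) (n : ℕ) {f g : WordOfLength d n → ℂ}
    (hf : f ∈ annihilator (hJ.isCoideal.toSubmodule.comap (ofCoeffs d n)))
    (hg : g ∈ annihilator (hJ.isCoideal.toSubmodule.comap (ofCoeffs d n))) :
    f * g ∈ annihilator (hJ.isCoideal.toSubmodule.comap (ofCoeffs d n)) := by
  intro x hx
  have hker : IsClosed[weakStarTopology (Fock2 d)]
      (LinearMap.ker (pairing f g) : Set (Fock2 d →L[ℂ] Fock2 d)) :=
    @IsClosed.preimage _ _ (weakStarTopology (Fock2 d)) _ _ (continuous_pairing f g) {0}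
      isClosed_singleton
  have hzero := weakStarSpan_subset hker (by
    rintro _ (⟨A, hA, B, _, rfl⟩ | ⟨A, _, B, hB, rfl⟩)
    · rw [SetLike.mem_coe, LinearMap.mem_ker, pairing_tensor, hf _ (hJ.homogProj_mem hA n),
        zero_mul]
    · rw [SetLike.mem_coe, LinearMap.mem_ker, pairing_tensor, hg _ (hJ.homogProj_mem hB n),
        mul_zero]) (hJ.isCoideal.comul_mem _ hx)
  rw [SetLike.mem_coe, LinearMap.mem_ker, pairing_comul, coeffs_ofCoeffs] at hzero
  exact hzero

/-- The congruence `u ∼ v ↔ L_u - L_v ∈ J` of a Hopf ideal. -/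
def IsHomogeneousHopfIdeal.con {J : Set (Fock d →L[ℂ] Fock d)}
    (hJ : IsHomogeneousHopfIdeal J) : Con (Word0 d) where
  r u v := L0 u - L0 v ∈ hJ.isCoideal.toSubmodule
  iseqv :=
    { refl := fun u => by rw [sub_self]; exact zero_mem _
      symm := fun {u v} h => by rw [← neg_sub]; exact neg_mem h
      trans := fun {u v w} h h' => by rw [← sub_add_sub_cancel]; exact add_mem h h' }
  mul' := fun {u u' v v'} h h' => by
    have : L0 (u * v) - L0 (u' * v') = (L0 u - L0 u') * L0 v + L0 u' * (L0 v - L0 v') := by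
      rw [L0_mul, L0_mul, sub_mul, mul_sub]; abel
    rw [this]
    exact add_mem (hJ.isIdeal.mul_mem_right _ h _ (L0_mem_Lalg v))
      (hJ.isIdeal.mul_mem_left _ (L0_mem_Lalg u') _ h')

lemma IsHomogeneousHopfIdeal.con_iff {J : Set (Fock d →L[ℂ] Fock d)}
    (hJ : IsHomogeneousHopfIdeal J) {u v : Word0 d} : hJ.con u v ↔ L0 u - L0 v ∈ J := Iff.rfl

/-- If the lengths differ, the component of `L u - L v` in degree `u.length` is `L u`, which then
lies in `J`. -/
lemma IsHomogeneousHopfIdeal.isHomogeneousCon {J : Set (Fock d →L[ℂ] Fock d)}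
    (hJ : IsHomogeneousHopfIdeal J) : IsHomogeneousCon hJ.con := by
  intro u v huv hu
  by_contra hlen
  refine hu ?_
  have := hJ.homogProj_mem (hJ.con_iff.1 huv) u.length
  rw [L0_coe, L0_coe, map_sub, homogProj_L, homogProj_L, if_pos rfl, if_neg (Ne.symm hlen),
    sub_zero] at this
  rw [hJ.con_iff, L0_coe, L0_zero, sub_zero]
  exact this

/-- This is `le_span_of_annihilator_mul` carried over to degree `n`: a basis vector in the
coefficient space of `J` means `u ∼ 0`, a difference means `u ∼ v`. -/
lemma IsHomogeneousHopfIdeal.mem_conSpan {J : Set (Fock d →L[ℂ] Fock d)}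
    (hJ : IsHomogeneousHopfIdeal J) {A : Fock d →L[ℂ] Fock d} (hA : A ∈ J) {n : ℕ}
    (hn : A ∈ homogeneousPart d n) : A ∈ conSpan hJ.con := by
  classical
  have hAn : ofCoeffs d n (coeffs d n A) = A := by
    rw [← homogProj_apply, homogProj_of_mem hn, if_pos rfl]
  have hle := le_span_of_annihilator_mul (hJ.isCoideal.toSubmodule.comap (ofCoeffs d n))
    (fun f hf g hg => hJ.mul_mem_annihilator n hf hg)
  have hspan : hJ.isCoideal.toSubmodule.comap (ofCoeffs d n) ≤
      (conSpan hJ.con).comap (ofCoeffs d n) := by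
    refine hle.trans (Submodule.span_le.2 ?_)
    rintro _ (⟨hx, u, rfl⟩ | ⟨hx, u, v, rfl⟩)
    · rw [Submodule.mem_comap, ofCoeffs_single] at hx
      rw [SetLike.mem_coe, Submodule.mem_comap, ofCoeffs_single]
      refine mem_conSpan_of_zero (u := ((u : Word d) : Word0 d)) ?_
      rw [hJ.con_iff, L0_coe, L0_zero, sub_zero]
      exact hx
    · rw [Submodule.mem_comap, map_sub, ofCoeffs_single, ofCoeffs_single] at hx
      rw [SetLike.mem_coe, Submodule.mem_comap, map_sub, ofCoeffs_single, ofCoeffs_single]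
      exact sub_mem_conSpan (u := ((u : Word d) : Word0 d)) (v := ((v : Word d) : Word0 d)) hx
  rw [← hAn]
  refine hspan ?_
  rw [Submodule.mem_comap, hAn]
  exact hA

theorem IsHomogeneousHopfIdeal.eq_weakStarSpan {J : Set (Fock d →L[ℂ] Fock d)}
    (hJ : IsHomogeneousHopfIdeal J) :
    J = weakStarSpan {T | ∃ u v : Word0 d, hJ.con u v ∧ T = L0 u - L0 v} := by
  refine Set.Subset.antisymm ?_ (weakStarSpan_subset (J := hJ.isCoideal.toSubmodule)
    hJ.isCoideal.closed ?_)
  · conv_lhs => rw [hJ.isHomogeneous]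
    refine weakStarSpan_mono (Submodule.span_le.2 ?_)
    rintro A ⟨hA, n, hn⟩
    exact hJ.mem_conSpan hA hn
  · rintro _ ⟨u, v, huv, rfl⟩
    exact huv

end FreeSemigroupAlgebra

end

theorem theorem3p3 (d : ℕ)
    (J : Set (FreeSemigroupAlgebra.Fock d →L[ℂ] FreeSemigroupAlgebra.Fock d))
    (hJ : J ⊆ FreeSemigroupAlgebra.Lalg d) :
    FreeSemigroupAlgebra.IsHomogeneousHopfIdeal J ↔
      ∃ c : Con (FreeSemigroupAlgebra.Word0 d),
        FreeSemigroupAlgebra.IsHomogeneousCon c ∧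
        J = FreeSemigroupAlgebra.weakStarSpan
          {T | ∃ u v : FreeSemigroupAlgebra.Word0 d, c u v ∧
            T = FreeSemigroupAlgebra.L0 u - FreeSemigroupAlgebra.L0 v} := by
  constructor
  · intro h
    exact ⟨h.con, h.isHomogeneousCon, h.eq_weakStarSpan⟩
  · rintro ⟨c, hc, rfl⟩
    exact FreeSemigroupAlgebra.isHomogeneousHopfIdeal_of_con hc
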